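/- Link diagrams are taken on $S^2$, up to isotopy of $S^2$. A third Reidemeister move (RIII) involves an upper, a middle and a lower strand; it is called an RIII$\alpha$ move if the middle strand belongs to a different link component than the upper strand and to a different link component than the lower strand. For a component $K$ of a link diagram let $f(K)$ be the cyclic sequence of letters $O$ (over) and $U$ (under) that is read along $K$ at the crossings of $K$ with other components, let $X_1X_2\cdots X_m$ be $f(K)$ cut open at any point, and put $\Phi(K)=\left|\tfrac12\sum_{i=1}^m\varepsilon(X_i)\right|$, where $\varepsilon(X_i)=+1$ if $X_i=O$ and $i$ is even or $X_i=U$ and $i$ is odd, and $\varepsilon(X_i)=-1$ otherwise (this does not depend on the cut). Theorem. For every natural number $n$ there is a diagram $D$ of the trivial 2-component link such that every finite sequence of Reidemeister moves that transforms $D$ into a diagram without crossings contains at least $n$ RIII$\alpha$ moves. Moreover, $D=K_1\cup K_2$ can be chosen such that $\Phi(K_1)=2n$ and $\Phi(K_2)=0$. -/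

import Mathlib

/-- A link diagram on the oriented sphere `S²`, up to orientation-preserving homeomorphism of `S²`.

The link components are oriented and carry finitely many points: the two passages through every
crossing, and possibly further *plain* points that only subdivide the curve; every component carries
at least one point. The edge of a point `p` is the piece of curve from `p` to `next p`. The pieces
of `S²` that remain when the curves are removed are the regions; a region need not be a disc, so
diagrams with several connected pieces are included, together with their relative position. -/
structure LinkDiagram where
  /-- the points on the curves -/
  P : Type
  finP : Finite P
  /-- the regions of the complement of the curves -/
  R : Type
  finR : Finite R
  /-- the next point along the oriented curve; the cycles are the link components -/
  next : Equiv.Perm P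
  /-- the other passage through the same crossing; plain points are fixed -/
  cross : P → P
  /-- `true` if `p` is the over-passage of a crossing -/
  isOver : P → Bool
  /-- `true` if `p` lies on a crossing whose other strand passes from the right to the left of
  the strand of `p` -/
  rtl : P → Bool
  /-- the region on the left of the edge from `p` to `next p` -/
  left : P → R
  /-- the region on the right of the edge from `p` to `next p` -/
  right : P → R
  cross_cross : ∀ p, cross (cross p) = p
  isOver_cross : ∀ p, cross p ≠ p → isOver (cross p) = !(isOver p)
  rtl_cross : ∀ p, cross p ≠ p → rtl (cross p) = !(rtl p)
  /-- convention for plain points -/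
  isOver_plain : ∀ p, cross p = p → isOver p = false
  /-- convention for plain points -/
  rtl_plain : ∀ p, cross p = p → rtl p = false
  /-- the regions do not change at a plain point -/
  side_plain : ∀ p, cross p = p →
    left p = left (next.symm p) ∧ right p = right (next.symm p)
  /-- the four corners at a crossing where the strand of `cross p` passes from the right to the
  left of the strand of `p`: front left, front right, back right, back left, as seen from `p` -/
  side_cross : ∀ p, rtl p = true →
    left p = right (cross p) ∧
    right p = right (next.symm (cross p)) ∧
    right (next.symm p) = left (next.symm (cross p)) ∧
    left (next.symm p) = left (cross p)
  /-- the surface is connected: any two regions are joined by a path across edges -/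
  connected : ∀ x y : R, Relation.EqvGen (fun x y => ∃ p, left p = x ∧ right p = y) x y
  /-- the surface is a sphere and every region is a planar domain: Euler's formula
  `V - E + F = 1 + C`, in which `V - E` is minus the number of crossings, `F` is the number of
  regions, and `C` is the number of connected pieces of the union of the curves -/
  euler : Nat.card R = Nat.card {p : P // cross p ≠ p ∧ isOver p = true} +
    Nat.card (Quotient (Relation.EqvGen.setoid (fun p q : P => q = next p ∨ q = cross p))) + 1

namespace LinkDiagram

/-- `p` and `q` lie on the same link component. -/
def SameComponent (D : LinkDiagram) (p q : D.P) : Prop := D.next.SameCycle p q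

/-- The number of link components. -/
noncomputable def numComponents (D : LinkDiagram) : ℕ :=
  Nat.card (Quotient (Equiv.Perm.SameCycle.setoid D.next))

/-- A diagram without crossings. -/
def IsTrivial (D : LinkDiagram) : Prop := ∀ p, D.cross p = p

/-- The edges that border the region `m` are exactly the edges of the points in `E`. -/
def Borders (D : LinkDiagram) (m : D.R) (E : Set D.P) : Prop :=
  ∀ p, p ∈ E ↔ (D.left p = m ∨ D.right p = m)

/-- `f` identifies the oriented curves of `D` with those of `D'`; the crossings agree away from
the points in `S`. -/
def AgreeOff (D D' : LinkDiagram) (f : D.P ≃ D'.P) (S : Set D.P) : Prop :=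
  (∀ p, f (D.next p) = D'.next (f p)) ∧
  ∀ p, p ∉ S → D'.cross (f p) = f (D.cross p) ∧ D'.isOver (f p) = D.isOver p ∧
    D'.rtl (f p) = D.rtl p

/-- Under the map `h` from the regions of `D'` to the regions of `D`, the two sides of all edges
agree, except for the edges of the points in `E`. -/
def SidesAgreeOff (D D' : LinkDiagram) (f : D.P ≃ D'.P) (h : D'.R → D.R) (E : Set D.P) : Prop :=
  ∀ p, p ∉ E → h (D'.left (f p)) = D.left p ∧ h (D'.right (f p)) = D.right p

/-- The diagrams are the same up to a renaming of points and regions. -/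
def Iso (D D' : LinkDiagram) : Prop :=
  ∃ (f : D.P ≃ D'.P) (h : D'.R ≃ D.R), AgreeOff D D' f ∅ ∧ SidesAgreeOff D D' f h ∅

/-- `D'` is the diagram `D` with one more plain point `v`. -/
def Subdivides (D D' : LinkDiagram) : Prop :=
  ∃ (f : D.P → D'.P) (g : D.R ≃ D'.R) (v : D'.P),
    Function.Injective f ∧ Set.range f = {v}ᶜ ∧ D'.cross v = v ∧ D'.next v ≠ v ∧
    ∀ p, ((D'.next (f p) = v ∧ f (D.next p) = D'.next v) ∨
        (D'.next (f p) ≠ v ∧ f (D.next p) = D'.next (f p))) ∧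
      D'.cross (f p) = f (D.cross p) ∧ D'.isOver (f p) = D.isOver p ∧ D'.rtl (f p) = D.rtl p ∧
      D'.left (f p) = g (D.left p) ∧ D'.right (f p) = g (D.right p)

/-- First Reidemeister move that creates a crossing: in `D'` the successive points `c`, `next c`,
plain in `D`, are the two passages through one crossing, and the edge between them bounds a monogon
`m`. The other regions are the same. -/
def RI (D D' : LinkDiagram) : Prop :=
  ∃ (f : D.P ≃ D'.P) (h : D'.R → D.R) (m : D'.R) (c : D.P),
    D.next c ≠ c ∧
    AgreeOff D D' f {c, D.next c} ∧
    D.cross c = c ∧ D.cross (D.next c) = D.next c ∧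
    D'.cross (f c) = f (D.next c) ∧
    D'.Borders m {f c} ∧
    SidesAgreeOff D D' f h {c}

/-- Second Reidemeister move that creates two crossings: in `D'` the points `a`, `next a` of one
strand, plain in `D`, cross over the points `b`, `next b` of another strand (in one of the two
orders), and the two edges bound a bigon `m`. The regions of `D` are the regions of `D'` other than
`m`, where the two regions that meet `m` only at its corners are joined. (No more regions can
be joined by `h`, by Euler's formula for `D` and `D'`.) -/
def RII (D D' : LinkDiagram) : Prop :=
  ∃ (f : D.P ≃ D'.P) (h : D'.R → D.R) (m : D'.R) (a b : D.P),
    [a, D.next a, b, D.next b].Nodup ∧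
    AgreeOff D D' f {a, D.next a, b, D.next b} ∧
    D.cross a = a ∧ D.cross (D.next a) = D.next a ∧
    D.cross b = b ∧ D.cross (D.next b) = D.next b ∧
    ((D'.cross (f a) = f b ∧ D'.cross (f (D.next a)) = f (D.next b)) ∨
      (D'.cross (f a) = f (D.next b) ∧ D'.cross (f (D.next a)) = f b)) ∧
    D'.isOver (f a) = true ∧ D'.isOver (f (D.next a)) = true ∧
    D'.Borders m {f a, f b} ∧
    SidesAgreeOff D D' f h {a, b}

/-- Third Reidemeister move with upper strand `a`, `next a`, middle strand `b`, `next b` and lower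
strand `c`, `next c`. In `D` any two of these strands cross once, and the three edges bound a
triangle `m`. In `D'` the order of the two crossings along each of the strands is reversed. -/
def RIII (D D' : LinkDiagram) (a b c : D.P) : Prop :=
  ∃ (f : D.P ≃ D'.P) (h : D'.R ≃ D.R) (m : D.R) (σ : Equiv.Perm D.P),
    [a, D.next a, b, D.next b, c, D.next c].Nodup ∧
    (∃ x ∈ ({a, D.next a} : Set D.P), D.cross x ∈ ({b, D.next b} : Set D.P)) ∧
    (∃ x ∈ ({b, D.next b} : Set D.P), D.cross x ∈ ({c, D.next c} : Set D.P)) ∧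
    (∃ x ∈ ({a, D.next a} : Set D.P), D.cross x ∈ ({c, D.next c} : Set D.P)) ∧
    D.isOver a = true ∧ D.isOver (D.next a) = true ∧
    D.isOver c = false ∧ D.isOver (D.next c) = false ∧
    D.Borders m {a, b, c} ∧
    -- the permutation `σ` exchanges the two points on each of the three strands
    σ a = D.next a ∧ σ (D.next a) = a ∧ σ b = D.next b ∧ σ (D.next b) = b ∧
    σ c = D.next c ∧ σ (D.next c) = c ∧
    (∀ p, p ∉ ({a, D.next a, b, D.next b, c, D.next c} : Set D.P) → σ p = p) ∧
    (∀ p, f (D.next p) = D'.next (f p)) ∧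
    (∀ p, D'.cross (f (σ p)) = f (σ (D.cross p)) ∧ D'.isOver (f (σ p)) = D.isOver p ∧
      D'.rtl (f (σ p)) = D.rtl p) ∧
    SidesAgreeOff D D' f h {a, b, c}

/-- A third Reidemeister move is of type `α` if the middle strand belongs to another component than
the upper strand and to another component than the lower strand. -/
def RIIIAlpha (D D' : LinkDiagram) : Prop :=
  ∃ a b c, RIII D D' a b c ∧ ¬ D.SameComponent a b ∧ ¬ D.SameComponent b c

/-- A third Reidemeister move that is not of type `α`. -/
def RIIIOther (D D' : LinkDiagram) : Prop :=
  ∃ a b c, RIII D D' a b c ∧ (D.SameComponent a b ∨ D.SameComponent b c)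

/-- Isotopies of the sphere and Reidemeister moves not of type `RIIIα`, in one direction. -/
def OtherMove (D D' : LinkDiagram) : Prop :=
  Iso D D' ∨ Subdivides D D' ∨ RI D D' ∨ RII D D' ∨ RIIIOther D D'

/-- `Transforms D D' m`: there is a finite sequence of Reidemeister moves (in both directions) and
isotopies of the sphere from `D` to `D'` in which exactly `m` moves are `RIIIα` moves. -/
inductive Transforms (D : LinkDiagram) : LinkDiagram → ℕ → Prop
  | refl : Transforms D D 0
  | other {E F : LinkDiagram} {m : ℕ} :
      Transforms D E m → (OtherMove E F ∨ OtherMove F E) → Transforms D F m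
  | alpha {E F : LinkDiagram} {m : ℕ} :
      Transforms D E m → (RIIIAlpha E F ∨ RIIIAlpha F E) → Transforms D F (m + 1)

/-- `D` is a diagram of the trivial `r`-component link: it represents the same link as a diagram of
`r` circles without crossings. -/
def IsDiagramOfTrivialLink (D : LinkDiagram) (r : ℕ) : Prop :=
  ∃ (T : LinkDiagram) (m : ℕ), T.IsTrivial ∧ T.numComponents = r ∧ Transforms D T m

/-- `p` is a passage through a crossing between two distinct components. -/
def IsNonSelf (D : LinkDiagram) (p : D.P) : Prop := ¬ D.SameComponent p (D.cross p)

open Classical in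
/-- The non-self OU sequence of the component through `p`, read from the base point `p`
(`true` is `O`, `false` is `U`). -/
noncomputable def ouSequence (D : LinkDiagram) (p : D.P) : List Bool :=
  (((List.range (Function.minimalPeriod D.next p)).map (fun i => (D.next)^[i] p)).filter
    (fun x => decide (D.IsNonSelf x))).map D.isOver

/-- The sign of the letter `X` in position `i` (positions are counted from `1`): `1` for `O` in an
even and `U` in an odd position, `-1` otherwise. -/
def letterSign (i : ℕ) (X : Bool) : ℚ :=
  if (X = true ∧ Even i) ∨ (X = false ∧ Odd i) then 1 else -1

/-- The OU number of a non-cyclic sequence. -/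
def seqOUNumber (S : List Bool) : ℚ :=
  (1 / 2) * ∑ i : Fin S.length, letterSign (i.val + 1) (S.get i)

/-- The OU number of the component through `p`: the absolute value of the OU number of the
non-self OU sequence, cut open at any base point. -/
noncomputable def ouNumber (D : LinkDiagram) (p : D.P) : ℚ := |seqOUNumber (D.ouSequence p)|

end LinkDiagram

/-! Lower bound. Along a component, read the letters at crossings with other components and let $A$
be the alternating sum of this word, so that $\Phi=|A|/2$. Moving the cut of a word of even length
only changes the sign of $A$. A first Reidemeister move and a plain point contribute no letters. A
second move between two components inserts $OO$ into one word and $UU$ into another, and such pairs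
cancel. A third move exchanges two neighbouring points on each of its three strands. Both points are
over-passages on the upper strand and under-passages on the lower one, so only the middle strand can
matter. It carries two different letters only if both of its crossings are non-self, which is the
case RIII$\alpha$; then $OU$ and $UO$ are exchanged and $A$ changes by at most 4 in absolute value.
A diagram without crossings has empty words, so $\Phi\le 2m$ if $m$ moves are of type RIII$\alpha$
and the length is even. This is `near_word_swap`, `nearDiagrams_otherMove` and
`ouNumber_le_of_transforms`.

Construction. `linkedChain n` has $n$ blocks reading $OUOU$ along $K_1$ and $UUOO$ along $K_2$, and
a block 0 reading $OO$ and $UU$. Hence $|A|=4n$ on $K_1$ and $A=0$ on $K_2$. In each of the $n$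
blocks one RIII$\alpha$ move pushes a self-crossing of $K_2$ across $K_1$ and produces $OOUU$ on
$K_1$; two second moves and one first move then clear the block (`transforms_stages`). Block 0 keeps
the diagram connected meanwhile and is removed last (`transforms_trivial`). Sides of edges and
Euler's formula are checked on finite tables, block by block. -/

namespace LinkDiagram

/-! ### Alternating sums of words -/

section Words

/-- The alternating sum of a word in the letters `O` (`true`) and `U` (`false`). -/
def altSum : List Bool → ℚ
  | [] => 0
  | x :: S => (if x = true then -1 else 1) - altSum S

theorem altSum_append (S T : List Bool) :
    altSum (S ++ T) = altSum S + (-1) ^ S.length * altSum T := by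
  induction S with
  | nil => simp [altSum]
  | cons x S ih => simp only [List.cons_append, altSum, ih, List.length_cons, pow_succ]; ring

theorem letterSign_succ (i : ℕ) (X : Bool) : letterSign (i + 1) X = -letterSign i X := by
  cases X <;> by_cases h : Even i <;> simp [letterSign, Nat.even_add_one, h, ← Nat.not_even_iff_odd]

/-- Positions start at 1, so a leading $O$ counts $-1$, and dropping the first letter flips all
later signs. -/
theorem seqOUNumber_eq (S : List Bool) : seqOUNumber S = 1 / 2 * altSum S := by
  have key : ∀ S : List Bool,
      ∑ i : Fin S.length, letterSign (i.val + 1) (S.get i) = altSum S := by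
    intro S
    induction S with
    | nil => simp [altSum]
    | cons x S ih =>
      have h := Fin.sum_univ_succ
        (fun i : Fin (S.length + 1) => letterSign (i.val + 1) ((x :: S).get i))
      refine h.trans ?_
      rw [altSum, ← ih, sub_eq_add_neg, ← Finset.sum_neg_distrib]
      congr 1
      · cases x <;> simp [letterSign]
      · exact Finset.sum_congr rfl fun i _ => by simp [letterSign_succ (i.val + 1)]
  rw [seqOUNumber, key]

/-- Two words have lengths of the same parity, and if the lengths are even, then the absolute
values of the alternating sums differ by at most `k`. -/
def Near (k : ℚ) (S T : List Bool) : Prop :=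
  (Even S.length ↔ Even T.length) ∧ (Even S.length → |(|altSum S| - |altSum T|)| ≤ k)

theorem Near.refl (S : List Bool) : Near 0 S S := ⟨Iff.rfl, fun _ => by simp⟩

theorem Near.symm {k : ℚ} {S T : List Bool} (h : Near k S T) : Near k T S :=
  ⟨h.1.symm, fun hT => by rw [abs_sub_comm]; exact h.2 (h.1.2 hT)⟩

theorem Near.trans {k l : ℚ} {S T U : List Bool} (h : Near k S T) (h' : Near l T U) :
    Near (k + l) S U :=
  ⟨h.1.trans h'.1, fun hS => (abs_sub_le _ _ _).trans (add_le_add (h.2 hS) (h'.2 (h.1.1 hS)))⟩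

theorem Near.trans_zero {k : ℚ} {S T U : List Bool} (h : Near k S T) (h' : Near 0 T U) :
    Near k S U := by simpa using h.trans h'

theorem Near.zero_trans {k : ℚ} {S T U : List Bool} (h : Near 0 S T) (h' : Near k T U) :
    Near k S U := by simpa using h.trans h'

/-- In even length, `x` passes from position 1 to an even position and all other letters shift by
one, so every sign flips. In odd length `x` would keep its sign; this is why `Near` bounds sums only
for even length. -/
theorem Near.rotate (x : Bool) (S : List Bool) : Near 0 (x :: S) (S ++ [x]) := by
  refine ⟨by simp, fun h => ?_⟩
  have hS : Odd S.length := by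
    rw [List.length_cons, Nat.even_add_one] at h
    exact Nat.not_even_iff_odd.1 h
  have e : altSum (x :: S) = -altSum (S ++ [x]) := by
    rw [altSum_append, hS.neg_one_pow]
    simp only [altSum]
    ring
  rw [e, abs_neg]
  simp

/-- The common tail starts at positions of equal parity, so its contributions cancel in the
difference. -/
theorem Near.append_right {k : ℚ} {u v : List Bool} (hp : Even u.length ↔ Even v.length)
    (hk : |altSum u - altSum v| ≤ k) (S : List Bool) : Near k (u ++ S) (v ++ S) := by
  refine ⟨by simp only [List.length_append, Nat.even_add, hp], fun _ => ?_⟩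
  have hpow : (-1 : ℚ) ^ u.length = (-1) ^ v.length := by
    by_cases h : Even u.length
    · rw [h.neg_one_pow, (hp.1 h).neg_one_pow]
    · rw [(Nat.not_even_iff_odd.1 h).neg_one_pow,
        (Nat.not_even_iff_odd.1 (fun h' => h (hp.2 h'))).neg_one_pow]
  refine (abs_abs_sub_abs_le_abs_sub _ _).trans ?_
  rw [altSum_append, altSum_append, hpow, add_sub_add_right_eq_sub]
  exact hk

end Words

/-! ### Words read along the cycles of a permutation -/

section Orbits

variable {P : Type} (s : Equiv.Perm P)

/-- The points of the cycle through `p`, in order and starting with `p`. -/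
noncomputable def orbitList (p : P) : List P :=
  (List.range (Function.minimalPeriod s p)).map fun i => s^[i] p

/-- The letters on the cycle through `p`, read from `p`. -/
noncomputable def word (g : P → Option Bool) (p : P) : List Bool := (orbitList s p).filterMap g

variable [Finite P]

theorem minimalPeriod_perm_pos (p : P) : 0 < Function.minimalPeriod s p :=
  Function.minimalPeriod_pos_of_mem_periodicPts
    (Function.Injective.mem_periodicPts s.injective p)

/-- Advancing the base point is a rotation of the list; the shared tail `t` reduces independence of
the cut to `Near.rotate`. -/
theorem orbitList_step (p : P) :
    ∃ t, orbitList s p = p :: t ∧ orbitList s (s p) = t ++ [p] := by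
  obtain ⟨M, hM⟩ := Nat.exists_eq_succ_of_ne_zero (minimalPeriod_perm_pos s p).ne'
  have hM' : Function.minimalPeriod s (s p) = M + 1 := by
    rw [Function.minimalPeriod_apply (Function.Injective.mem_periodicPts s.injective p), hM]
  refine ⟨(List.range M).map fun i => s^[i] (s p), ?_, ?_⟩
  · rw [orbitList, hM, List.range_succ_eq_map]
    simp [Function.comp_def]
  · rw [orbitList, hM', List.range_succ, List.map_append]
    have : s^[M + 1] p = p := by
      have := Function.iterate_minimalPeriod (f := s) (x := p)
      rwa [hM] at this
    simpa using this

omit [Finite P] in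
theorem orbitList_nodup (p : P) : (orbitList s p).Nodup := by
  refine List.Nodup.map_on ?_ List.nodup_range
  intro i hi j hj h
  exact Function.iterate_injOn_Iio_minimalPeriod (List.mem_range.1 hi) (List.mem_range.1 hj) h

omit [Finite P] in
theorem sameCycle_iterate (p : P) (k : ℕ) : s.SameCycle p (s^[k] p) :=
  ⟨k, by simp [Equiv.Perm.iterate_eq_pow]⟩

omit [Finite P] in
theorem sameCycle_of_mem_orbitList {p q : P} (h : q ∈ orbitList s p) : s.SameCycle p q := by
  obtain ⟨i, -, rfl⟩ := List.mem_map.1 h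
  exact sameCycle_iterate s p i

theorem exists_iterate_of_sameCycle {p q : P} (h : s.SameCycle p q) : ∃ k : ℕ, s^[k] p = q := by
  obtain ⟨k, -, hk⟩ := h.exists_pow_eq'
  exact ⟨k, by rw [Equiv.Perm.iterate_eq_pow]; exact hk⟩

theorem near_word_next (g : P → Option Bool) (p : P) : Near 0 (word s g p) (word s g (s p)) := by
  obtain ⟨t, h1, h2⟩ := orbitList_step s p
  rw [word, word, h1, h2, List.filterMap_append]
  cases hg : g p with
  | none => simpa [hg] using Near.refl _
  | some x => simpa [hg] using Near.rotate x _

theorem near_word_of_sameCycle (g : P → Option Bool) {p q : P} (h : s.SameCycle p q) :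
    Near 0 (word s g p) (word s g q) := by
  obtain ⟨k, rfl⟩ := exists_iterate_of_sameCycle s h
  induction k with
  | zero => exact Near.refl _
  | succ k ih =>
    rw [Function.iterate_succ_apply']
    exact (ih (sameCycle_iterate s p k)).trans_zero (near_word_next s g _)

omit [Finite P] in
theorem word_congr {g g' : P → Option Bool} {p : P}
    (h : ∀ x, s.SameCycle p x → g' x = g x) : word s g' p = word s g p :=
  List.filterMap_congr fun x hx => h x (sameCycle_of_mem_orbitList s hx)

/-- The effect of a change of the letters at two successive points. -/
theorem near_word_of_change {g g' : P → Option Bool} {a : P} (ha : s a ≠ a)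
    (hg : ∀ x, x ≠ a → x ≠ s a → g' x = g x) {k : ℚ}
    (hp : Even ([a, s a].filterMap g).length ↔ Even ([a, s a].filterMap g').length)
    (hk : |altSum ([a, s a].filterMap g) - altSum ([a, s a].filterMap g')| ≤ k) (p : P) :
    Near k (word s g p) (word s g' p) := by
  have hk0 : 0 ≤ k := (abs_nonneg _).trans hk
  -- On the cycle of `a` the base point is moved to `a`, so that the altered letters form a prefix;
  -- other cycles do not see the change.
  by_cases h : s.SameCycle p a
  · refine (near_word_of_sameCycle s g h).zero_trans
      (Near.trans_zero ?_ (near_word_of_sameCycle s g' h.symm))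
    obtain ⟨t, h1, h2⟩ := orbitList_step s a
    obtain ⟨r, h3, -⟩ := orbitList_step s (s a)
    have ht : ∃ r', t = s a :: r' := by
      cases t with
      | nil => rw [h3] at h2; simp at h2; exact absurd h2.1 ha
      | cons y r' => rw [h3] at h2; simp at h2; exact ⟨r', by rw [h2.1]⟩
    obtain ⟨r', rfl⟩ := ht
    have hnd := orbitList_nodup s a
    rw [h1] at hnd
    simp only [List.nodup_cons, List.mem_cons, not_or] at hnd
    have e : r'.filterMap g' = r'.filterMap g := List.filterMap_congr fun x hx =>
      hg x (fun hxa => hnd.1.2 (hxa ▸ hx)) (fun hxa => hnd.2.1 (hxa ▸ hx))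
    have e1 : a :: s a :: r' = [a, s a] ++ r' := rfl
    rw [word, word, h1, e1, List.filterMap_append, List.filterMap_append, e]
    exact Near.append_right hp hk _
  · rw [word_congr s (g := g) (g' := g') fun x hx => hg x (fun hxa => h (hxa ▸ hx))
      (fun hxa => h (hx.trans (hxa ▸ (sameCycle_iterate s a 1).symm)))]
    exact ⟨Iff.rfl, fun _ => by simpa using hk0⟩

open Classical in
-- The worst case is $OU$ against $UO$, with sums $-2$ and $2$.
theorem near_word_swap (g : P → Option Bool) {a : P} (ha : s a ≠ a) (p : P) :
    Near 4 (word s g p) (word s (g ∘ Equiv.swap a (s a)) p) := by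
  refine near_word_of_change s ha (fun x h1 h2 => by
    simp [Equiv.swap_apply_of_ne_of_ne h1 h2]) ?_ ?_ p
  · rcases hx : g a with _ | x <;> rcases hy : g (s a) with _ | y <;> simp [hx, hy]
  · rcases hx : g a with _ | x <;> rcases hy : g (s a) with _ | y
    · simp [hx, hy]
    · simp [hx, hy]
    · simp [hx, hy]
    · cases x <;> cases y <;> simp [hx, hy, altSum] <;> norm_num

open Classical in
theorem near_word_swap_zero (g : P → Option Bool) {a : P} (ha : s a ≠ a)
    (h : g a = none ∨ g (s a) = none ∨ g a = g (s a)) (p : P) :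
    Near 0 (word s g p) (word s (g ∘ Equiv.swap a (s a)) p) := by
  refine near_word_of_change s ha (fun x h1 h2 => by
    simp [Equiv.swap_apply_of_ne_of_ne h1 h2]) ?_ ?_ p
  · rcases hx : g a with _ | x <;> rcases hy : g (s a) with _ | y <;> simp [hx, hy]
  · rcases hx : g a with _ | x <;> rcases hy : g (s a) with _ | y <;> simp [hx, hy] at h ⊢
    simp [h]

/-- Two equal consecutive letters have alternating sum 0 and preserve the parity of the length. -/
theorem near_word_insert {g g' : P → Option Bool} {a : P} (ha : s a ≠ a) (X : Bool)
    (hg : ∀ x, x ≠ a → x ≠ s a → g' x = g x) (h1 : g a = none) (h2 : g (s a) = none)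
    (h3 : g' a = some X) (h4 : g' (s a) = some X) (p : P) :
    Near 0 (word s g p) (word s g' p) := by
  refine near_word_of_change s ha hg ?_ ?_ p
  · simp [h1, h2, h3, h4]
  · simp [h1, h2, h3, h4, altSum]

omit [Finite P] in
theorem orbitList_transport {P' : Type} {s' : Equiv.Perm P'} (f : P ≃ P')
    (hf : ∀ x, f (s x) = s' (f x)) (p : P) : orbitList s' (f p) = (orbitList s p).map f := by
  have hit : ∀ k, s'^[k] (f p) = f (s^[k] p) := fun k => by
    induction k with
    | zero => rfl
    | succ k ih => rw [Function.iterate_succ_apply', Function.iterate_succ_apply', hf, ih]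
  have hper : Function.minimalPeriod s' (f p) = Function.minimalPeriod s p := by
    rw [Function.minimalPeriod_eq_minimalPeriod_iff]
    intro k
    rw [Function.IsPeriodicPt, Function.IsFixedPt, hit, f.injective.eq_iff]
    rfl
  simp only [orbitList, hper, hit, List.map_map, Function.comp_def]

omit [Finite P] in
theorem word_transport {P' : Type} {s' : Equiv.Perm P'} (f : P ≃ P')
    (hf : ∀ x, f (s x) = s' (f x)) (g' : P' → Option Bool) (p : P) :
    word s' g' (f p) = word s (g' ∘ f) p := by
  rw [word, orbitList_transport s f hf, word, List.filterMap_map]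

omit [Finite P] in
theorem sameCycle_transport {P' : Type} {s' : Equiv.Perm P'} (f : P ≃ P')
    (hf : ∀ x, f (s x) = s' (f x)) (p q : P) : s'.SameCycle (f p) (f q) ↔ s.SameCycle p q := by
  have hs : s' = (f.symm.trans s).trans f := Equiv.ext fun y => by
    obtain ⟨x, rfl⟩ := f.surjective y
    simp [hf]
  have h2 : ∀ k : ℤ, (s' ^ k) (f p) = f ((s ^ k) p) := by
    have hconj : s' = f.permCongr s := by rw [hs]; rfl
    intro k
    have : s' ^ k = f.permCongr (s ^ k) := by
      rw [hconj, ← Equiv.permCongrHom_coe, ← map_zpow]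
    simp [this]
  exact ⟨fun ⟨k, hk⟩ => ⟨k, f.injective (by rw [← h2, hk])⟩, fun ⟨k, hk⟩ => ⟨k, by rw [h2, hk]⟩⟩

end Orbits

/-! ### The effect of Reidemeister moves on the words -/

section Moves

open Classical in
/-- The letter read at a point, if the point lies on a crossing of two components. -/
noncomputable def letter (D : LinkDiagram) (x : D.P) : Option Bool :=
  if D.IsNonSelf x then some (D.isOver x) else none

theorem ouSequence_eq_word (D : LinkDiagram) (p : D.P) :
    D.ouSequence p = word D.next D.letter p := by
  rw [ouSequence, word, orbitList]
  generalize (List.range _).map _ = l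
  induction l with
  | nil => rfl
  | cons x l ih => by_cases h : D.IsNonSelf x <;> simp_all [letter]

theorem ouNumber_eq (D : LinkDiagram) (p : D.P) :
    D.ouNumber p = 1 / 2 * |altSum (word D.next D.letter p)| := by
  rw [ouNumber, seqOUNumber_eq, abs_mul, ouSequence_eq_word]
  norm_num

theorem letter_eq_none {D : LinkDiagram} {x : D.P} (h : D.SameComponent x (D.cross x)) :
    D.letter x = none := by simp [letter, IsNonSelf, h]

theorem letter_plain {D : LinkDiagram} {x : D.P} (h : D.cross x = x) : D.letter x = none :=
  letter_eq_none (h.symm ▸ Equiv.Perm.SameCycle.refl _ _)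

theorem letter_eq_some {D : LinkDiagram} {x : D.P} (h : ¬ D.SameComponent x (D.cross x)) :
    D.letter x = some (D.isOver x) := by simp [letter, IsNonSelf, h]

theorem letter_congr {D D' : LinkDiagram} {x : D.P} {y : D'.P}
    (h : D'.SameComponent y (D'.cross y) ↔ D.SameComponent x (D.cross x))
    (ho : D'.isOver y = D.isOver x) : D'.letter y = D.letter x := by
  by_cases hx : D.SameComponent x (D.cross x)
  · rw [letter_eq_none hx, letter_eq_none (h.2 hx)]
  · rw [letter_eq_some hx, letter_eq_some (fun hy => hx (h.1 hy)), ho]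

theorem sameComponent_next (D : LinkDiagram) (x : D.P) : D.SameComponent x (D.next x) :=
  sameCycle_iterate D.next x 1

/-- The words of `D` and `D'` at corresponding points differ by at most `k`. -/
def NearAt (k : ℚ) (D D' : LinkDiagram) (p : D.P) (p' : D'.P) : Prop :=
  Near k (word D.next D.letter p) (word D'.next D'.letter p')

/-- Every component of one of the diagrams has a component of the other one whose word differs
by at most `k`. -/
def NearDiagrams (k : ℚ) (D D' : LinkDiagram) : Prop :=
  (∀ p, ∃ p', NearAt k D D' p p') ∧ ∀ p', ∃ p, NearAt k D D' p p'

theorem NearDiagrams.symm {k : ℚ} {D D' : LinkDiagram} (h : NearDiagrams k D D') :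
    NearDiagrams k D' D :=
  ⟨fun p => (h.2 p).imp fun _ => Near.symm, fun p => (h.1 p).imp fun _ => Near.symm⟩

/-- Pulling the letters of `D'` back along `f` leaves two letterings of the same cycles to compare.
-/
theorem nearDiagrams_of_equiv {k : ℚ} {D D' : LinkDiagram} (f : D.P ≃ D'.P)
    (hf : ∀ p, f (D.next p) = D'.next (f p))
    (h : ∀ p, Near k (word D.next D.letter p) (word D.next (D'.letter ∘ f) p)) :
    NearDiagrams k D D' := by
  have key : ∀ p, NearAt k D D' p (f p) := fun p => by
    rw [NearAt, word_transport D.next f hf]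
    exact h p
  exact ⟨fun p => ⟨_, key p⟩, fun p' => ⟨f.symm p', by simpa using key (f.symm p')⟩⟩

theorem letter_of_agreeOff {D D' : LinkDiagram} {f : D.P ≃ D'.P} {S : Set D.P}
    (h : AgreeOff D D' f S) {p : D.P} (hp : p ∉ S) : D'.letter (f p) = D.letter p := by
  obtain ⟨h1, h2, -⟩ := h.2 p hp
  refine letter_congr ?_ h2
  rw [h1]
  exact sameCycle_transport D.next f h.1 _ _

theorem nearDiagrams_iso {D D' : LinkDiagram} (h : Iso D D') : NearDiagrams 0 D D' := by
  obtain ⟨f, -, hA, -⟩ := h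
  refine nearDiagrams_of_equiv f hA.1 fun p => ?_
  rw [word_congr D.next (g := D.letter) (g' := D'.letter ∘ f)
    fun x _ => letter_of_agreeOff hA (Set.notMem_empty x)]
  exact Near.refl _

/-- The new crossing joins consecutive points of one curve, so it is a self-crossing and carries no
letters. -/
theorem nearDiagrams_RI {D D' : LinkDiagram} (h : RI D D') : NearDiagrams 0 D D' := by
  obtain ⟨f, -, -, c, -, hA, hc, hc', hx, -⟩ := h
  have hx' : D'.cross (f (D.next c)) = f c := by rw [← hx, D'.cross_cross]
  refine nearDiagrams_of_equiv f hA.1 fun p => ?_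
  rw [word_congr D.next (g := D.letter) (g' := D'.letter ∘ f)]
  · exact Near.refl _
  · intro x _
    by_cases h1 : x = c
    · subst h1
      rw [Function.comp_apply, letter_plain hc, letter_eq_none]
      rw [SameComponent, hx, sameCycle_transport D.next f hA.1]
      exact D.sameComponent_next x
    by_cases h2 : x = D.next c
    · subst h2
      rw [Function.comp_apply, letter_plain hc', letter_eq_none]
      rw [SameComponent, hx', sameCycle_transport D.next f hA.1]
      exact (D.sameComponent_next c).symm
    · exact letter_of_agreeOff hA (by simp [h1, h2])

open Classical in
theorem nearDiagrams_RII {D D' : LinkDiagram} (h : RII D D') : NearDiagrams 0 D D' := by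
  obtain ⟨f, -, -, a, b, hnd, hA, ha, ha', hb, hb', hx, hoa, hoa', -⟩ := h
  have := D.finP
  simp only [List.nodup_cons, List.mem_cons, List.not_mem_nil, or_false, not_or] at hnd
  obtain ⟨⟨haa, hab, hab'⟩, ⟨hab'', hab'''⟩, hbb, -⟩ := hnd
  have hsa := D.sameComponent_next a
  have hsb := D.sameComponent_next b
  -- Only the component of the partner point matters, so both orders of the crossings can be treated
  -- at once from here on.
  have hc1 : ∃ y, D.SameComponent b y ∧ D'.cross (f a) = f y := by
    rcases hx with h | h
    · exact ⟨b, .refl _ _, h.1⟩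
    · exact ⟨_, hsb, h.1⟩
  have hc2 : ∃ y, D.SameComponent b y ∧ D'.cross (f (D.next a)) = f y := by
    rcases hx with h | h
    · exact ⟨_, hsb, h.2⟩
    · exact ⟨b, .refl _ _, h.2⟩
  have hc3 : ∃ y, D.SameComponent a y ∧ D'.cross (f b) = f y ∧ D'.isOver (f b) = false := by
    rcases hx with h | h
    · refine ⟨a, .refl _ _, by rw [← h.1, D'.cross_cross], ?_⟩
      rw [← h.1, D'.isOver_cross _ (by rw [h.1]; exact f.injective.ne (Ne.symm hab)), hoa]
      rfl
    · refine ⟨_, hsa, by rw [← h.2, D'.cross_cross], ?_⟩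
      rw [← h.2, D'.isOver_cross _ (by rw [h.2]; exact f.injective.ne (Ne.symm hab'')), hoa']
      rfl
  have hc4 : ∃ y, D.SameComponent a y ∧ D'.cross (f (D.next b)) = f y ∧
      D'.isOver (f (D.next b)) = false := by
    rcases hx with h | h
    · refine ⟨_, hsa, by rw [← h.2, D'.cross_cross], ?_⟩
      rw [← h.2, D'.isOver_cross _ (by rw [h.2]; exact f.injective.ne (Ne.symm hab''')), hoa']
      rfl
    · refine ⟨a, .refl _ _, by rw [← h.1, D'.cross_cross], ?_⟩
      rw [← h.1, D'.isOver_cross _ (by rw [h.1]; exact f.injective.ne (Ne.symm hab')), hoa]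
      rfl
  obtain ⟨y1, hy1, hx1⟩ := hc1
  obtain ⟨y2, hy2, hx2⟩ := hc2
  obtain ⟨y3, hy3, hx3, ho3⟩ := hc3
  obtain ⟨y4, hy4, hx4, ho4⟩ := hc4
  have hoff : ∀ x, x ≠ a → x ≠ D.next a → x ≠ b → x ≠ D.next b →
      D'.letter (f x) = D.letter x := fun x h1 h2 h3 h4 =>
    letter_of_agreeOff hA (by simp [h1, h2, h3, h4])
  have htr := sameCycle_transport D.next f hA.1
  refine nearDiagrams_of_equiv f hA.1 fun p => ?_
  by_cases hs : D.SameComponent a b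
  · rw [word_congr D.next (g := D.letter) (g' := D'.letter ∘ f)]
    · exact Near.refl _
    · intro x _
      rw [Function.comp_apply]
      by_cases h1 : x = a
      · rw [h1, letter_plain ha, letter_eq_none]
        rw [SameComponent, hx1, htr]
        exact hs.trans hy1
      by_cases h2 : x = D.next a
      · rw [h2, letter_plain ha', letter_eq_none]
        rw [SameComponent, hx2, htr]
        exact hsa.symm.trans (hs.trans hy2)
      by_cases h3 : x = b
      · rw [h3, letter_plain hb, letter_eq_none]
        rw [SameComponent, hx3, htr]
        exact hs.symm.trans hy3
      by_cases h4 : x = D.next b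
      · rw [h4, letter_plain hb', letter_eq_none]
        rw [SameComponent, hx4, htr]
        exact hsb.symm.trans (hs.symm.trans hy4)
      exact hoff x h1 h2 h3 h4
  · have l1 : D'.letter (f a) = some true := by
      rw [letter_eq_some, hoa]
      rw [SameComponent, hx1, htr]
      exact fun h => hs (h.trans hy1.symm)
    have l2 : D'.letter (f (D.next a)) = some true := by
      rw [letter_eq_some, hoa']
      rw [SameComponent, hx2, htr]
      exact fun h => hs (hsa.trans (h.trans hy2.symm))
    have l3 : D'.letter (f b) = some false := by
      rw [letter_eq_some, ho3]
      rw [SameComponent, hx3, htr]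
      exact fun h => hs (hy3.trans h.symm)
    have l4 : D'.letter (f (D.next b)) = some false := by
      rw [letter_eq_some, ho4]
      rw [SameComponent, hx4, htr]
      exact fun h => hs (hy4.trans (h.symm.trans hsb.symm))
    -- An intermediate lettering, not required to come from a diagram: $OO$ is already inserted on
    -- the upper strand, $UU$ not yet on the lower one.
    let g : D.P → Option Bool := fun x =>
      if x = a ∨ x = D.next a then some true else D.letter x
    have n1 : Near 0 (word D.next D.letter p) (word D.next g p) :=
      near_word_insert D.next (Ne.symm haa) true (fun x h1 h2 => by simp [g, h1, h2])
        (letter_plain ha) (letter_plain ha') (by simp [g]) (by simp [g]) p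
    refine n1.zero_trans (near_word_insert D.next (a := b) (Ne.symm hbb) false ?_ ?_ ?_ l3 l4 p)
    · intro x h3 h4
      by_cases h1 : x = a
      · simp [g, h1, l1]
      by_cases h2 : x = D.next a
      · simp [g, h2, l2]
      simp [g, h1, h2, hoff x h1 h2 h3 h4]
    · simp [g, Ne.symm hab, Ne.symm hab'', letter_plain hb]
    · simp only [g, Ne.symm hab', Ne.symm hab''', or_self, if_false, letter_plain hb']

open Classical in
-- `σ` moves points only within their components, so non-self crossings stay non-self and letters
-- travel with the points. As `σ` is a product of three disjoint transpositions, these can be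
-- studied separately.
theorem letter_RIII {D D' : LinkDiagram} {a b c : D.P} (h : RIII D D' a b c) :
    ∃ f : D.P ≃ D'.P, (∀ p, f (D.next p) = D'.next (f p)) ∧
      [a, D.next a, b, D.next b, c, D.next c].Nodup ∧
      D'.letter ∘ f = ((D.letter ∘ Equiv.swap a (D.next a)) ∘ Equiv.swap b (D.next b)) ∘
        Equiv.swap c (D.next c) := by
  obtain ⟨f, -, -, σ, hnd, -, -, -, -, -, -, -, -, s1, s2, s3, s4, s5, s6, s7, hf, hx, -⟩ := h
  refine ⟨f, hf, hnd, ?_⟩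
  simp only [List.nodup_cons, List.mem_cons, List.not_mem_nil, or_false, not_or] at hnd
  obtain ⟨⟨n1, n2, n3, n4, n5⟩, ⟨n6, n7, n8, n9⟩, ⟨n10, n11, n12⟩, ⟨n13, n14⟩, n15, -⟩ := hnd
  have hσ : ∀ x, x = a ∨ x = D.next a ∨ x = b ∨ x = D.next b ∨ x = c ∨ x = D.next c ∨
      σ x = x ∧ x ≠ a ∧ x ≠ D.next a ∧ x ≠ b ∧ x ≠ D.next b ∧ x ≠ c ∧ x ≠ D.next c := by
    intro x
    have := s7 x
    simp only [Set.mem_insert_iff, Set.mem_singleton_iff, not_or] at this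
    tauto
  have hcomp : ∀ x, D.SameComponent (σ x) x := by
    intro x
    rcases hσ x with rfl | rfl | rfl | rfl | rfl | rfl | hh
    · rw [s1]; exact (D.sameComponent_next _).symm
    · rw [s2]; exact D.sameComponent_next _
    · rw [s3]; exact (D.sameComponent_next _).symm
    · rw [s4]; exact D.sameComponent_next _
    · rw [s5]; exact (D.sameComponent_next _).symm
    · rw [s6]; exact D.sameComponent_next _
    · rw [hh.1]; exact .refl _ _
  have hl : ∀ x, D'.letter (f (σ x)) = D.letter x := by
    intro x
    obtain ⟨h1, h2, -⟩ := hx x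
    have : D.next.SameCycle (σ x) (σ (D.cross x)) ↔ D.next.SameCycle x (D.cross x) :=
      ⟨fun h => (hcomp x).symm.trans (h.trans (hcomp _)),
        fun h => (hcomp x).trans (h.trans (hcomp _).symm)⟩
    refine letter_congr ?_ h2
    rw [h1]
    exact (sameCycle_transport D.next f hf _ _).trans this
  have hl' : ∀ {x y}, σ y = x → D'.letter (f x) = D.letter y := fun h => h ▸ hl _
  funext x
  simp only [Function.comp_apply]
  rcases hσ x with e | e | e | e | e | e | ⟨h0, h1, h2, h3, h4, h5, h6⟩
  · rw [e, Equiv.swap_apply_of_ne_of_ne n4 n5, Equiv.swap_apply_of_ne_of_ne n2 n3,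
      Equiv.swap_apply_left, hl' s2]
  · rw [e, Equiv.swap_apply_of_ne_of_ne n8 n9, Equiv.swap_apply_of_ne_of_ne n6 n7,
      Equiv.swap_apply_right, hl' s1]
  · rw [e, Equiv.swap_apply_of_ne_of_ne n11 n12, Equiv.swap_apply_left,
      Equiv.swap_apply_of_ne_of_ne (Ne.symm n3) (Ne.symm n7), hl' s4]
  · rw [e, Equiv.swap_apply_of_ne_of_ne n13 n14, Equiv.swap_apply_right,
      Equiv.swap_apply_of_ne_of_ne (Ne.symm n2) (Ne.symm n6), hl' s3]
  · rw [e, Equiv.swap_apply_left, Equiv.swap_apply_of_ne_of_ne (Ne.symm n12) (Ne.symm n14),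
      Equiv.swap_apply_of_ne_of_ne (Ne.symm n5) (Ne.symm n9), hl' s6]
  · rw [e, Equiv.swap_apply_right, Equiv.swap_apply_of_ne_of_ne (Ne.symm n11) (Ne.symm n13),
      Equiv.swap_apply_of_ne_of_ne (Ne.symm n4) (Ne.symm n8), hl' s5]
  · rw [Equiv.swap_apply_of_ne_of_ne h5 h6, Equiv.swap_apply_of_ne_of_ne h3 h4,
      Equiv.swap_apply_of_ne_of_ne h1 h2, hl' h0]

theorem letter_swappable {D : LinkDiagram} {x y : D.P} (h : D.isOver x = D.isOver y) :
    D.letter x = none ∨ D.letter y = none ∨ D.letter x = D.letter y := by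
  by_cases hx : D.IsNonSelf x <;> by_cases hy : D.IsNonSelf y <;> simp [letter, hx, hy, h]

open Classical in
/-- Only the letters on the middle strand matter for the effect of a third Reidemeister move. -/
theorem nearDiagrams_RIII {D D' : LinkDiagram} {a b c : D.P} (h : RIII D D' a b c) {k : ℚ}
    (hk : ∀ g : D.P → Option Bool, g b = D.letter b → g (D.next b) = D.letter (D.next b) →
      ∀ p, Near k (word D.next g p) (word D.next (g ∘ Equiv.swap b (D.next b)) p)) :
    NearDiagrams k D D' := by
  have := D.finP
  obtain ⟨f, hf, hnd, hl⟩ := letter_RIII h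
  obtain ⟨-, -, -, -, -, -, -, -, ha, ha', hc, hc', -⟩ := h
  simp only [List.nodup_cons, List.mem_cons, List.not_mem_nil, or_false, not_or] at hnd
  obtain ⟨⟨n1, n2, n3, n4, n5⟩, ⟨n6, n7, n8, n9⟩, ⟨n10, n11, n12⟩, ⟨n13, n14⟩, n15, -⟩ := hnd
  refine nearDiagrams_of_equiv f hf fun p => ?_
  rw [hl]
  -- The exchanges are made on the upper, middle and lower strand in turn. When `hk` is applied, the
  -- letters on the upper strand are already exchanged, so `g` is not `D.letter` but agrees with it
  -- on the middle strand.
  refine (near_word_swap_zero D.next D.letter (Ne.symm n1)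
    (letter_swappable (ha.trans ha'.symm)) p).zero_trans ?_
  refine (hk _ ?_ ?_ p).trans_zero (near_word_swap_zero D.next _ (Ne.symm n15) ?_ p)
  · rw [Function.comp_apply, Equiv.swap_apply_of_ne_of_ne (Ne.symm n2) (Ne.symm n6)]
  · rw [Function.comp_apply, Equiv.swap_apply_of_ne_of_ne (Ne.symm n3) (Ne.symm n7)]
  · simp only [Function.comp_apply]
    rw [Equiv.swap_apply_of_ne_of_ne (Ne.symm n11) (Ne.symm n13),
      Equiv.swap_apply_of_ne_of_ne (Ne.symm n4) (Ne.symm n8),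
      Equiv.swap_apply_of_ne_of_ne (Ne.symm n12) (Ne.symm n14),
      Equiv.swap_apply_of_ne_of_ne (Ne.symm n5) (Ne.symm n9)]
    exact letter_swappable (hc.trans hc'.symm)

theorem next_ne_of_RIII {D D' : LinkDiagram} {a b c : D.P} (h : RIII D D' a b c) :
    D.next b ≠ b := by
  obtain ⟨-, -, -, -, hnd, -⟩ := h
  simp only [List.nodup_cons, List.mem_cons, List.not_mem_nil, or_false, not_or] at hnd
  exact Ne.symm hnd.2.2.1.1

theorem nearDiagrams_RIIIAlpha {D D' : LinkDiagram} (h : RIIIAlpha D D') :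
    NearDiagrams 4 D D' := by
  have := D.finP
  obtain ⟨a, b, c, h, -⟩ := h
  exact nearDiagrams_RIII h fun g _ _ p => near_word_swap D.next g (next_ne_of_RIII h) p

/-- The middle strand crosses both other strands. If it shares a component with one of them, that
crossing is a self-crossing, so at most one of the two exchanged points carries a letter. -/
theorem nearDiagrams_RIIIOther {D D' : LinkDiagram} (h : RIIIOther D D') :
    NearDiagrams 0 D D' := by
  have := D.finP
  obtain ⟨a, b, c, h, hs⟩ := h
  refine nearDiagrams_RIII h fun g g1 g2 p =>
    near_word_swap_zero D.next g (next_ne_of_RIII h) ?_ p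
  rw [g1, g2]
  obtain ⟨-, -, -, -, -, ⟨x, hx, hx'⟩, ⟨y, hy, hy'⟩, -⟩ := h
  have hstrand : ∀ {u v : D.P}, v ∈ ({u, D.next u} : Set D.P) → D.SameComponent u v := by
    rintro u v (rfl | rfl)
    · exact .refl _ _
    · exact D.sameComponent_next u
  have key : ∃ z ∈ ({b, D.next b} : Set D.P), D.letter z = none := by
    rcases hs with hs | hs
    · refine ⟨_, hx', letter_eq_none ?_⟩
      rw [D.cross_cross]
      exact (hstrand hx').symm.trans (hs.symm.trans (hstrand hx))
    · exact ⟨y, hy, letter_eq_none ((hstrand hy).symm.trans (hs.trans (hstrand hy')))⟩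
  obtain ⟨z, rfl | rfl, hz⟩ := key
  · exact Or.inl hz
  · exact Or.inr (Or.inl hz)

/-- The new point carries no letter, but it lengthens its cycle by one, so there is no equivalence
of points to transport along and the orbits are compared by hand. -/
theorem nearDiagrams_subdivides {D D' : LinkDiagram} (h : Subdivides D D') :
    NearDiagrams 0 D D' := by
  have := D.finP
  have := D'.finP
  obtain ⟨f, _, v, hinj, hran, hv, hvv, hall⟩ := h
  have hfv : ∀ x, f x ≠ v := fun x => by
    have : f x ∈ ({v}ᶜ : Set D'.P) := hran ▸ Set.mem_range_self x
    simpa using this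
  have hsurj : ∀ y, y ≠ v → ∃ x, f x = y := fun y hy => by
    have : y ∈ Set.range f := by rw [hran]; simpa using hy
    exact this
  obtain ⟨u, hu⟩ := hsurj (D'.next.symm v) (fun h => hvv (by
    conv_lhs => rw [← h]
    simp))
  have hnu : D'.next (f u) = v := by rw [hu]; simp
  have hnu' : D'.next v = f (D.next u) := by
    rcases (hall u).1 with h | h
    · exact h.2.symm
    · exact absurd hnu h.1
  have hstep : ∀ x, x ≠ u → D'.next (f x) = f (D.next x) := fun x hx => by
    rcases (hall x).1 with h | h
    · exact absurd (hinj (D'.next.injective (h.1.trans hnu.symm))) hx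
    · exact h.2.symm
  have hsame : ∀ x y, D'.SameComponent (f x) (f y) ↔ D.SameComponent x y := by
    have hfwd : ∀ x, D'.SameComponent (f x) (f (D.next x)) := fun x => by
      by_cases hx : x = u
      · subst hx
        have h1 := D'.sameComponent_next (f x)
        have h2 := D'.sameComponent_next v
        rw [hnu] at h1
        rw [hnu'] at h2
        exact h1.trans h2
      · rw [← hstep x hx]; exact D'.sameComponent_next _
    intro x y
    constructor
    · intro h
      obtain ⟨k, hk⟩ := exists_iterate_of_sameCycle _ h
      -- The orbit in `D'` stays in the image of the orbit in `D`, except for the visits to `v`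
      -- between `f u` and `f (D.next u)`.
      have inv : ∀ k, (∃ z, D.SameComponent x z ∧ D'.next^[k] (f x) = f z) ∨
          D.SameComponent x u ∧ D'.next^[k] (f x) = v := by
        intro k
        induction k with
        | zero => exact Or.inl ⟨x, .refl _ _, rfl⟩
        | succ k ih =>
          rw [Function.iterate_succ_apply']
          rcases ih with ⟨z, hz, he⟩ | ⟨hz, he⟩
          · by_cases hzu : z = u
            · subst hzu
              exact Or.inr ⟨hz, by rw [he, hnu]⟩
            · exact Or.inl ⟨_, hz.trans (D.sameComponent_next z), by rw [he, hstep z hzu]⟩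
          · exact Or.inl ⟨_, hz.trans (D.sameComponent_next u), by rw [he, hnu']⟩
      rcases inv k with ⟨z, hz, he⟩ | ⟨-, he⟩
      · rwa [hinj (hk.symm.trans he)]
      · exact absurd (hk.symm.trans he) (hfv y)
    · intro h
      obtain ⟨k, rfl⟩ := exists_iterate_of_sameCycle _ h
      clear h
      have : ∀ k, D'.SameComponent (f x) (f (D.next^[k] x)) := fun k => by
        induction k with
        | zero => exact .refl _ _
        | succ k ih =>
          rw [Function.iterate_succ_apply']
          exact ih.trans (hfwd _)
      exact this k
  have hletter : ∀ x, D'.letter (f x) = D.letter x := fun x => by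
    obtain ⟨-, h1, h2, -⟩ := hall x
    refine letter_congr ?_ h2
    rw [h1]
    exact hsame _ _
  have key : ∀ x, ¬ D.SameComponent x u → NearAt 0 D D' x (f x) := by
    intro x hx
    have hit : ∀ k, D'.next^[k] (f x) = f (D.next^[k] x) := fun k => by
      induction k with
      | zero => rfl
      | succ k ih =>
        rw [Function.iterate_succ_apply', Function.iterate_succ_apply', ih, hstep]
        rintro h
        exact hx (h ▸ sameCycle_iterate _ _ k)
    have hper : Function.minimalPeriod D'.next (f x) = Function.minimalPeriod D.next x := by
      rw [Function.minimalPeriod_eq_minimalPeriod_iff]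
      intro k
      rw [Function.IsPeriodicPt, Function.IsFixedPt, hit, hinj.eq_iff]
      rfl
    have : word D'.next D'.letter (f x) = word D.next D.letter x := by
      simp only [word, orbitList, hper, hit, List.filterMap_map, Function.comp_def, hletter]
    rw [NearAt, this]
    exact Near.refl _
  -- With the base point directly behind `v`, the new point is read last: the lists agree under `f`
  -- up to this final entry, and the periods are `M + 1` and `M + 2`.
  have keyu : NearAt 0 D D' (D.next u) (f (D.next u)) := by
    obtain ⟨M, hM⟩ := Nat.exists_eq_succ_of_ne_zero
      (minimalPeriod_perm_pos D.next (D.next u)).ne'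
    have hlast : D.next^[M] (D.next u) = u := by
      apply D.next.injective
      rw [← Function.iterate_succ_apply' D.next, ← hM,
        Function.iterate_minimalPeriod]
    have hne : ∀ k < M, D.next^[k] (D.next u) ≠ u := fun k hk he => by
      have := Function.iterate_injOn_Iio_minimalPeriod (f := D.next) (x := D.next u)
        (Set.mem_Iio.2 (show k < _ by omega)) (Set.mem_Iio.2 (show M < _ by omega))
        (he.trans hlast.symm)
      omega
    have hit : ∀ k ≤ M, D'.next^[k] (f (D.next u)) = f (D.next^[k] (D.next u)) := by
      intro k hk
      induction k with
      | zero => rfl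
      | succ k ih =>
        rw [Function.iterate_succ_apply', Function.iterate_succ_apply', ih (by omega),
          hstep _ (hne k (by omega))]
    have hitM : D'.next^[M + 1] (f (D.next u)) = v := by
      rw [Function.iterate_succ_apply', hit M le_rfl, hlast, hnu]
    have hper : Function.minimalPeriod D'.next (f (D.next u)) = M + 2 := by
      have hp : Function.IsPeriodicPt D'.next (M + 2) (f (D.next u)) := by
        rw [Function.IsPeriodicPt, Function.IsFixedPt, Function.iterate_succ_apply', hitM, hnu']
      have hle := hp.minimalPeriod_le (by omega)
      have hpos := minimalPeriod_perm_pos D'.next (f (D.next u))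
      have hmin := Function.isPeriodicPt_minimalPeriod D'.next (f (D.next u))
      by_contra hcon
      rcases Nat.lt_or_ge (Function.minimalPeriod D'.next (f (D.next u))) (M + 1) with hlt | hge
      · rw [Function.IsPeriodicPt, Function.IsFixedPt, hit _ (by omega), hinj.eq_iff] at hmin
        have := Function.IsPeriodicPt.minimalPeriod_le hpos hmin
        omega
      · rw [show Function.minimalPeriod D'.next (f (D.next u)) = M + 1 by omega,
          Function.IsPeriodicPt, Function.IsFixedPt, hitM] at hmin
        exact hfv _ hmin.symm
    have : word D'.next D'.letter (f (D.next u)) = word D.next D.letter (D.next u) := by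
      rw [word, word, orbitList, orbitList, hper, hM, List.range_succ, List.map_append,
        List.filterMap_append]
      have hl : (List.range (M + 1)).map (fun i => D'.next^[i] (f (D.next u))) =
          (List.range (M + 1)).map (fun i => f (D.next^[i] (D.next u))) :=
        List.map_congr_left fun i hi => hit i (by have := List.mem_range.1 hi; omega)
      rw [hl]
      simp only [List.filterMap_map, Function.comp_def, hletter, List.map_cons, List.map_nil, hitM,
        List.filterMap_cons, letter_plain hv, List.filterMap_nil, List.append_nil]
    rw [NearAt, this]
    exact Near.refl _
  have keyall : ∀ x, NearAt 0 D D' x (f x) := by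
    intro x
    by_cases hx : D.SameComponent x u
    · have hx' : D.SameComponent x (D.next u) := hx.trans (D.sameComponent_next u)
      exact (near_word_of_sameCycle D.next D.letter hx').zero_trans
        (Near.trans_zero keyu (near_word_of_sameCycle D'.next D'.letter ((hsame _ _).2 hx').symm))
    · exact key x hx
  refine ⟨fun p => ⟨_, keyall p⟩, fun p' => ?_⟩
  by_cases hp : p' = v
  · subst hp
    refine ⟨D.next u, Near.trans_zero keyu ?_⟩
    rw [← hnu']
    exact (near_word_next D'.next D'.letter p').symm
  · obtain ⟨x, rfl⟩ := hsurj p' hp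
    exact ⟨x, keyall x⟩

theorem nearDiagrams_otherMove {D D' : LinkDiagram} (h : OtherMove D D') :
    NearDiagrams 0 D D' := by
  rcases h with h | h | h | h | h
  · exact nearDiagrams_iso h
  · exact nearDiagrams_subdivides h
  · exact nearDiagrams_RI h
  · exact nearDiagrams_RII h
  · exact nearDiagrams_RIIIOther h

/-- The errors add up along the sequence; inverse moves cost the same because `NearDiagrams` is
symmetric. -/
theorem exists_nearAt_of_transforms {D E : LinkDiagram} {m : ℕ} (h : Transforms D E m) (p : D.P) :
    ∃ q, NearAt (4 * m) D E p q := by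
  induction h with
  | refl => exact ⟨p, by simpa [NearAt] using Near.refl _⟩
  | other _ hm ih =>
    obtain ⟨q, hq⟩ := ih
    obtain ⟨r, hr⟩ := (hm.elim nearDiagrams_otherMove
      fun h => (nearDiagrams_otherMove h).symm).1 q
    exact ⟨r, Near.trans_zero hq hr⟩
  | alpha _ hm ih =>
    obtain ⟨q, hq⟩ := ih
    obtain ⟨r, hr⟩ := (hm.elim nearDiagrams_RIIIAlpha
      fun h => (nearDiagrams_RIIIAlpha h).symm).1 q
    refine ⟨r, ?_⟩
    have := Near.trans hq hr
    rw [NearAt]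
    push_cast
    rwa [mul_add, mul_one]

/-- A component with a non-self OU sequence of even length bounds the number of `RIIIα` moves that
are needed to remove all crossings. -/
theorem ouNumber_le_of_transforms {D T : LinkDiagram} {m : ℕ} (h : Transforms D T m)
    (hT : T.IsTrivial) (p : D.P) (hp : Even (D.ouSequence p).length) : D.ouNumber p ≤ 2 * m := by
  obtain ⟨q, hq⟩ := exists_nearAt_of_transforms h p
  have hw : word T.next T.letter q = [] :=
    List.filterMap_eq_nil_iff.2 fun x _ => letter_plain (hT x)
  rw [ouSequence_eq_word] at hp
  have := hq.2 hp
  rw [hw, altSum, abs_zero, sub_zero, abs_abs] at this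
  rw [ouNumber_eq]
  linarith

end Moves

/-! ### Chains of blocks

Two parallel circles `K₁` and `K₂` are divided into `n + 1` successive blocks. A block contains the
points `0`, …, `3` of `K₁` and the points `4`, …, `9` of `K₂`, and it is in one of six stages:

* `0`: `K₁` and `K₂` have four crossings, which are read `OUOU` along `K₁` and `UUOO` along `K₂`,
  and `K₂` has one more crossing, which is separated from `K₂` outside of the block by `K₁`;
* `1`: the crossing of `K₂` with itself is moved across `K₁`;
* `2`: the last two crossings of `K₁` and `K₂` are removed;
* `3`: the first two crossings of `K₁` and `K₂` are removed, too;
* `4`: there are no crossings;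
* `5`: only the first two crossings of `K₁` and `K₂` in stage `1` are present. -/

section Chain

/-- The other passage through the same crossing, for the points of a block. -/
def crossTab : Fin 6 → Fin 10 → Fin 10 :=
  ![![4, 7, 6, 9, 0, 8, 2, 1, 5, 3],
    ![4, 5, 8, 9, 0, 1, 7, 6, 2, 3],
    ![4, 5, 2, 3, 0, 1, 7, 6, 8, 9],
    ![0, 1, 2, 3, 4, 5, 7, 6, 8, 9],
    ![0, 1, 2, 3, 4, 5, 6, 7, 8, 9],
    ![4, 5, 2, 3, 0, 1, 6, 7, 8, 9]]

/-- The over-passages of a block. -/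
def overTab : Fin 6 → Fin 10 → Bool :=
  ![![true, false, true, false, false, false, false, true, true, true],
    ![true, true, false, false, false, false, false, true, true, true],
    ![true, true, false, false, false, false, false, true, false, false],
    ![false, false, false, false, false, false, false, true, false, false],
    ![false, false, false, false, false, false, false, false, false, false],
    ![true, true, false, false, false, false, false, false, false, false]]

/-- The points of a block whose strand is crossed from the right to the left. -/
def rtlTab : Fin 6 → Fin 10 → Bool :=
  ![![false, false, true, true, true, false, false, true, true, false],
    ![false, true, false, true, true, false, false, true, true, false],
    ![false, true, false, false, true, false, false, true, false, false],
    ![false, false, false, false, false, false, false, true, false, false],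
    ![false, false, false, false, false, false, false, false, false, false],
    ![false, true, false, false, true, false, false, false, false, false]]

/-- The regions on the left of the edges of a block: the region between the two curves after the
block (`0`), the regions inside the block (`1`, …, `4`), the regions on the other side of
`K₁` (`5`) and of `K₂` (`6`), and the region between the two curves before the block (`7`). -/
def leftTab : Fin 6 → Fin 10 → Fin 8 :=
  ![![6, 4, 6, 0, 1, 2, 4, 2, 3, 6],
    ![6, 2, 6, 0, 1, 6, 4, 6, 3, 6],
    ![6, 0, 0, 0, 1, 6, 4, 6, 6, 6],
    ![0, 0, 0, 0, 6, 6, 4, 6, 6, 6],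
    ![0, 0, 0, 0, 6, 6, 6, 6, 6, 6],
    ![6, 0, 0, 0, 1, 6, 6, 6, 6, 6]]

/-- The regions on the right of the edges of a block, as in `leftTab`. -/
def rightTab : Fin 6 → Fin 10 → Fin 8 :=
  ![![1, 2, 3, 5, 5, 3, 6, 1, 5, 0],
    ![1, 5, 3, 5, 5, 2, 6, 2, 5, 0],
    ![1, 5, 5, 5, 5, 0, 6, 0, 0, 0],
    ![5, 5, 5, 5, 0, 0, 6, 0, 0, 0],
    ![5, 5, 5, 5, 0, 0, 0, 0, 0, 0],
    ![1, 5, 5, 5, 5, 0, 0, 0, 0, 0]]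

/-- The regions that a block in the given stage contributes: `0` is the region between the two
curves after the block, if it is not the one before the block. -/
def cellTab : Fin 6 → Fin 5 → Bool :=
  ![![true, true, true, true, true],
    ![true, true, true, true, true],
    ![true, true, false, false, true],
    ![false, false, false, false, true],
    ![false, false, false, false, false],
    ![true, true, false, false, false]]

/-- The name in `leftTab` and `rightTab` of a region of a block. -/
def cellName : Fin 5 → Fin 8 := ![0, 1, 2, 3, 4]

def succTab : Fin 10 → Fin 10 := ![1, 2, 3, 0, 5, 6, 7, 8, 9, 4]

def predTab : Fin 10 → Fin 10 := ![3, 0, 1, 2, 9, 4, 5, 6, 7, 8]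

/-- The points `0` and `4` are entered from the preceding block, whose region `0` is called `7`
here. -/
def prevLeftTab (s : Fin 6) (x : Fin 10) : Fin 8 :=
  if x = 0 then 7 else if x = 4 then 6 else leftTab s (predTab x)

def prevRightTab (s : Fin 6) (x : Fin 10) : Fin 8 :=
  if x = 0 then 5 else if x = 4 then 7 else rightTab s (predTab x)

variable {n : ℕ}

/-- The points of a chain. -/
abbrev ChainPoint (n : ℕ) := Fin (n + 1) × Fin 10

/-- The possible regions of a chain. -/
abbrev ChainRegion (n : ℕ) := Bool ⊕ (Fin (n + 1) × Fin 5)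

/-- The next point of a chain. -/
def chainNext (n : ℕ) : Equiv.Perm (ChainPoint n) where
  toFun p := (if p.2 = 3 ∨ p.2 = 9 then p.1 + 1 else p.1, succTab p.2)
  invFun p := (if p.2 = 0 ∨ p.2 = 4 then p.1 - 1 else p.1, predTab p.2)
  left_inv := by
    rintro ⟨i, x⟩
    fin_cases x <;> simp [succTab, predTab]
  right_inv := by
    rintro ⟨i, x⟩
    fin_cases x <;> simp [succTab, predTab]

/-- The block after which the region between the curves behind the block `i` begins. -/
def owner (st : Fin (n + 1) → Fin 6) (i : Fin (n + 1)) : Fin (n + 1) :=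
  if cellTab (st i) 0 = true then i else 0

/-- The region with the given name in `leftTab` and `rightTab`. -/
def chainRegion (st : Fin (n + 1) → Fin 6) (i : Fin (n + 1)) (y : Fin 8) : ChainRegion n :=
  match y with
  | 0 => .inr (owner st i, 0)
  | 1 => .inr (i, 1)
  | 2 => .inr (i, 2)
  | 3 => .inr (i, 3)
  | 4 => .inr (i, 4)
  | 5 => .inl true
  | 6 => .inl false
  | 7 => .inr (owner st (i - 1), 0)

/-- The regions that are present in a chain. -/
def chainAlive (st : Fin (n + 1) → Fin 6) : ChainRegion n → Bool
  | .inl _ => true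
  | .inr (i, l) => cellTab (st i) l || (decide (l = 0) && decide (i = 0))

/-- The given name is that of a region that is present next to a block in the given stage. -/
def symAlive (s : Fin 6) (y : Fin 8) : Bool :=
  match y with
  | 1 => cellTab s 1
  | 2 => cellTab s 2
  | 3 => cellTab s 3
  | 4 => cellTab s 4
  | _ => true

/-- The admissible stages of the blocks of a chain. -/
def ValidChain (st : Fin (n + 1) → Fin 6) : Prop :=
  (∀ i, cellTab (st i) 0 = false → owner st (i - 1) = 0) ∧
    (cellTab (st 0) 0 = true ∨ ∀ i, st i = 4)

theorem chainAlive_owner (st : Fin (n + 1) → Fin 6) (i : Fin (n + 1)) :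
    chainAlive st (.inr (owner st i, 0)) = true := by
  by_cases h : cellTab (st i) 0 = true
  · simp [owner, chainAlive, h]
  · simp only [owner, h]
    simp [chainAlive]

theorem chainAlive_chainRegion (st : Fin (n + 1) → Fin 6) (i : Fin (n + 1)) (y : Fin 8)
    (h : symAlive (st i) y = true) : chainAlive st (chainRegion st i y) = true := by
  fin_cases y
  · exact chainAlive_owner st i
  · simpa [chainAlive, chainRegion, symAlive] using h
  · simpa [chainAlive, chainRegion, symAlive] using h
  · simpa [chainAlive, chainRegion, symAlive] using h
  · simpa [chainAlive, chainRegion, symAlive] using h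
  · rfl
  · rfl
  · exact chainAlive_owner st (i - 1)

theorem symAlive_leftTab : ∀ s x, symAlive s (leftTab s x) = true := by decide

theorem symAlive_rightTab : ∀ s x, symAlive s (rightTab s x) = true := by decide

def chainLeft (st : Fin (n + 1) → Fin 6) (p : ChainPoint n) : {r // chainAlive st r = true} :=
  ⟨chainRegion st p.1 (leftTab (st p.1) p.2),
    chainAlive_chainRegion st _ _ (symAlive_leftTab _ _)⟩

def chainRight (st : Fin (n + 1) → Fin 6) (p : ChainPoint n) : {r // chainAlive st r = true} :=
  ⟨chainRegion st p.1 (rightTab (st p.1) p.2),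
    chainAlive_chainRegion st _ _ (symAlive_rightTab _ _)⟩

theorem leftTab_three : ∀ s, leftTab s 3 = 0 := by decide
theorem leftTab_nine : ∀ s, leftTab s 9 = 6 := by decide
theorem rightTab_three : ∀ s, rightTab s 3 = 5 := by decide
theorem rightTab_nine : ∀ s, rightTab s 9 = 0 := by decide

theorem chainNext_symm_apply (i : Fin (n + 1)) (x : Fin 10) :
    (chainNext n).symm (i, x) = (if x = 0 ∨ x = 4 then i - 1 else i, predTab x) := rfl

theorem chainLeft_prev (st : Fin (n + 1) → Fin 6) (i : Fin (n + 1)) (x : Fin 10) :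
    (chainLeft st ((chainNext n).symm (i, x))).1 = chainRegion st i (prevLeftTab (st i) x) := by
  rw [chainNext_symm_apply]
  by_cases h0 : x = 0
  · subst h0
    simp [chainLeft, prevLeftTab, predTab, leftTab_three, chainRegion]
  by_cases h4 : x = 4
  · subst h4
    simp [chainLeft, prevLeftTab, predTab, leftTab_nine, chainRegion]
  · simp [chainLeft, prevLeftTab, h0, h4]

theorem chainRight_prev (st : Fin (n + 1) → Fin 6) (i : Fin (n + 1)) (x : Fin 10) :
    (chainRight st ((chainNext n).symm (i, x))).1 = chainRegion st i (prevRightTab (st i) x) := by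
  rw [chainNext_symm_apply]
  by_cases h0 : x = 0
  · subst h0
    simp [chainRight, prevRightTab, predTab, rightTab_three, chainRegion]
  by_cases h4 : x = 4
  · subst h4
    simp [chainRight, prevRightTab, predTab, rightTab_nine, chainRegion]
  · simp [chainRight, prevRightTab, h0, h4]

/-- The names `0` and `7` can differ at a plain point only in a block without crossings of $K_1$ and
$K_2$, where they denote the same region by `chainRegion_own_eq_prev`. -/
theorem side_plain_tab : ∀ s x, crossTab s x = x →
    (leftTab s x = prevLeftTab s x ∨
      leftTab s x = 0 ∧ prevLeftTab s x = 7 ∧ cellTab s 0 = false) ∧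
    (rightTab s x = prevRightTab s x ∨
      rightTab s x = 0 ∧ prevRightTab s x = 7 ∧ cellTab s 0 = false) := by decide

theorem side_cross_tab : ∀ s x, rtlTab s x = true →
    leftTab s x = rightTab s (crossTab s x) ∧
    rightTab s x = prevRightTab s (crossTab s x) ∧
    prevRightTab s x = prevLeftTab s (crossTab s x) ∧
    prevLeftTab s x = leftTab s (crossTab s x) := by decide

/-- The strip between the curves runs through such a block. Admissibility makes both of its names
refer to the region owned by block 0. -/
theorem chainRegion_own_eq_prev {st : Fin (n + 1) → Fin 6} (h : ValidChain st) {i : Fin (n + 1)}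
    (hi : cellTab (st i) 0 = false) : chainRegion st i 0 = chainRegion st i 7 := by
  have h1 := h.1 i hi
  simp only [chainRegion, h1]
  simp [owner, hi]

/-- The curve on which a point lies: `true` for `K₁`. -/
def onFirst (p : ChainPoint n) : Bool := decide (p.2 < 4)

theorem onFirst_chainNext (p : ChainPoint n) : onFirst (chainNext n p) = onFirst p := by
  obtain ⟨i, x⟩ := p
  fin_cases x <;> rfl

theorem ofNat_succ_eq (k : ℕ) : Fin.ofNat (n + 1) (k + 1) = Fin.ofNat (n + 1) k + 1 := by
  simp [Fin.ext_iff, Fin.val_add]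

theorem chainNext_iterate_four (k : ℕ) :
    (chainNext n)^[4 * k] (0, 0) = (Fin.ofNat (n + 1) k, 0) := by
  induction k with
  | zero => rfl
  | succ k ih =>
    rw [show 4 * (k + 1) = 4 + 4 * k by ring, Function.iterate_add_apply, ih, ofNat_succ_eq]
    rfl

theorem chainNext_iterate_six (k : ℕ) :
    (chainNext n)^[6 * k] (0, 4) = (Fin.ofNat (n + 1) k, 4) := by
  induction k with
  | zero => rfl
  | succ k ih =>
    rw [show 6 * (k + 1) = 6 + 6 * k by ring, Function.iterate_add_apply, ih, ofNat_succ_eq]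
    rfl

theorem sameCycle_base (i : Fin (n + 1)) (x : Fin 10) :
    (chainNext n).SameCycle (0, if x < 4 then 0 else 4) (i, x) := by
  have h0 : (chainNext n).SameCycle (0, 0) (i, 0) := by
    have := sameCycle_iterate (chainNext n) (0, 0) (4 * i)
    rw [chainNext_iterate_four] at this
    simpa using this
  have h4 : (chainNext n).SameCycle (0, 4) (i, 4) := by
    have := sameCycle_iterate (chainNext n) (0, 4) (6 * i)
    rw [chainNext_iterate_six] at this
    simpa using this
  fin_cases x
  · exact h0
  · exact h0.trans (sameCycle_iterate _ (i, 0) 1)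
  · exact h0.trans (sameCycle_iterate _ (i, 0) 2)
  · exact h0.trans (sameCycle_iterate _ (i, 0) 3)
  · exact h4
  · exact h4.trans (sameCycle_iterate _ (i, 4) 1)
  · exact h4.trans (sameCycle_iterate _ (i, 4) 2)
  · exact h4.trans (sameCycle_iterate _ (i, 4) 3)
  · exact h4.trans (sameCycle_iterate _ (i, 4) 4)
  · exact h4.trans (sameCycle_iterate _ (i, 4) 5)

theorem sameCycle_chainNext_iff (p q : ChainPoint n) :
    (chainNext n).SameCycle p q ↔ onFirst p = onFirst q := by
  constructor
  · intro h
    obtain ⟨k, rfl⟩ := exists_iterate_of_sameCycle _ h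
    clear h
    induction k with
    | zero => rfl
    | succ k ih => rw [Function.iterate_succ_apply', onFirst_chainNext]; exact ih
  · intro h
    refine (sameCycle_base p.1 p.2).symm.trans ?_
    have : (p.2 < 4 ↔ q.2 < 4) := by simpa [onFirst] using h
    simp only [this]
    exact sameCycle_base q.1 q.2

theorem card_quotient_eq_two (r : Setoid (ChainPoint n))
    (h : ∀ p q, r p q ↔ onFirst p = onFirst q) : Nat.card (Quotient r) = 2 := by
  have e : Function.Bijective
      (Quotient.lift (onFirst (n := n)) fun p q hpq => (h p q).1 hpq) := by
    constructor
    · rintro ⟨p⟩ ⟨q⟩ hpq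
      exact Quotient.sound ((h p q).2 hpq)
    · rintro (_ | _)
      · exact ⟨Quotient.mk r (0, 4), rfl⟩
      · exact ⟨Quotient.mk r (0, 0), rfl⟩
  rw [Nat.card_congr (Equiv.ofBijective _ e)]
  simp

/-- The other passage through the same crossing in a chain. -/
def chainCross (st : Fin (n + 1) → Fin 6) (p : ChainPoint n) : ChainPoint n :=
  (p.1, crossTab (st p.1) p.2)

def chainOver (st : Fin (n + 1) → Fin 6) (p : ChainPoint n) : Bool := overTab (st p.1) p.2

def chainSetoid (st : Fin (n + 1) → Fin 6) : Setoid (ChainPoint n) :=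
  Relation.EqvGen.setoid fun p q => q = chainNext n p ∨ q = chainCross st p

theorem chainSetoid_of_sameCycle (st : Fin (n + 1) → Fin 6) {p q : ChainPoint n}
    (h : (chainNext n).SameCycle p q) : chainSetoid st p q := by
  obtain ⟨k, rfl⟩ := exists_iterate_of_sameCycle _ h
  clear h
  induction k with
  | zero => exact .refl _
  | succ k ih =>
    rw [Function.iterate_succ_apply']
    exact .trans _ _ _ ih (.rel _ _ (Or.inl rfl))

theorem crossTab_zero : ∀ s, cellTab s 0 = true → crossTab s 0 = 4 := by decide

theorem card_chainSetoid_of_linked {st : Fin (n + 1) → Fin 6} (h : cellTab (st 0) 0 = true) :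
    Nat.card (Quotient (chainSetoid st)) = 1 := by
  have h04 : chainSetoid st (0, 0) (0, 4) :=
    .rel _ _ (Or.inr (by simp [chainCross, crossTab_zero _ h]))
  have key : ∀ p, chainSetoid st (0, 0) p := by
    rintro ⟨i, x⟩
    have := chainSetoid_of_sameCycle st (sameCycle_base i x)
    by_cases hx : x < 4
    · simpa [hx] using this
    · simp only [hx, if_false] at this
      exact .trans _ _ _ h04 this
  rw [Nat.card_eq_one_iff_unique]
  refine ⟨⟨?_⟩, ⟨Quotient.mk _ (0, 0)⟩⟩
  rintro ⟨p⟩ ⟨q⟩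
  exact Quotient.sound ((chainSetoid st).trans ((chainSetoid st).symm (key p)) (key q))

theorem crossTab_four : ∀ x, crossTab 4 x = x := by decide

theorem card_chainSetoid_of_trivial {st : Fin (n + 1) → Fin 6} (h : ∀ i, st i = 4) :
    Nat.card (Quotient (chainSetoid st)) = 2 := by
  refine card_quotient_eq_two _ fun p q => ⟨fun hpq => ?_, fun hpq => ?_⟩
  · induction hpq with
    | rel p q hpq =>
      rcases hpq with rfl | rfl
      · exact (onFirst_chainNext p).symm
      · rw [chainCross, h, crossTab_four]
    | refl => rfl
    | symm _ _ _ ih => exact ih.symm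
    | trans _ _ _ _ _ ih ih' => exact ih.trans ih'
  · exact chainSetoid_of_sameCycle st ((sameCycle_chainNext_iff p q).2 hpq)

/-- Each block contributes as many regions as crossings, which makes Euler's formula a local check.
-/
theorem sum_cellTab : ∀ s : Fin 6, (∑ l : Fin 5, if cellTab s l = true then 1 else 0) =
    ∑ x : Fin 10, if crossTab s x ≠ x ∧ overTab s x = true then 1 else 0 := by decide

theorem card_chainCrossings (st : Fin (n + 1) → Fin 6) :
    Nat.card {p : ChainPoint n // chainCross st p ≠ p ∧ chainOver st p = true} =
      ∑ i, ∑ l : Fin 5, if cellTab (st i) l = true then 1 else 0 := by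
  rw [Nat.card_eq_fintype_card, Fintype.card_subtype, Finset.card_filter, Fintype.sum_prod_type]
  refine Finset.sum_congr rfl fun i _ => ?_
  rw [sum_cellTab]
  simp [chainCross, chainOver]

theorem card_chainAlive (st : Fin (n + 1) → Fin 6) :
    Nat.card {r : ChainRegion n // chainAlive st r = true} =
      2 + ∑ i, ∑ l : Fin 5,
        if (cellTab (st i) l || (decide (l = 0) && decide (i = 0))) = true then 1 else 0 := by
  rw [Nat.card_eq_fintype_card, Fintype.card_subtype, Finset.card_filter, Fintype.sum_sum_type,
    Fintype.sum_prod_type]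
  rfl

/-- After the blocks cancel, a linked chain has two outer regions against $1+1$. In the trivial
chain the annulus `(0, 0)` makes up for the second connected piece. -/
theorem chain_euler {st : Fin (n + 1) → Fin 6} (h : ValidChain st) :
    Nat.card {r : ChainRegion n // chainAlive st r = true} =
      Nat.card {p : ChainPoint n // chainCross st p ≠ p ∧ chainOver st p = true} +
        Nat.card (Quotient (chainSetoid st)) + 1 := by
  rw [card_chainAlive, card_chainCrossings]
  rcases h.2 with h0 | h0
  · rw [card_chainSetoid_of_linked h0]
    have : ∀ i l, (cellTab (st i) l || (decide (l = 0) && decide (i = 0))) =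
        cellTab (st i) l := by
      intro i l
      by_cases hl : l = 0
      · by_cases hi : i = 0
        · subst hl hi
          simp [h0]
        · simp [hi]
      · simp [hl]
    simp only [this]
    ring
  · rw [card_chainSetoid_of_trivial h0]
    have : ∀ l, cellTab 4 l = false := by decide
    simp [h0, this, ite_and]

/-- These edges lead from the inner regions towards the outer ones; region `2` needs different edges
in the stages `0` and `1`. -/
theorem regions_connected_tab : ∀ s : Fin 6,
    (cellTab s 1 = true → leftTab s 4 = 1 ∧ rightTab s 4 = 5) ∧
    (cellTab s 2 = true → (leftTab s 5 = 2 ∧ rightTab s 5 = 3) ∨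
      (leftTab s 1 = 2 ∧ rightTab s 1 = 5)) ∧
    (cellTab s 3 = true → leftTab s 8 = 3 ∧ rightTab s 8 = 5) ∧
    (cellTab s 4 = true → leftTab s 6 = 4 ∧ rightTab s 6 = 6) := by decide

theorem chain_connected (st : Fin (n + 1) → Fin 6) (x y : {r // chainAlive st r = true}) :
    Relation.EqvGen (fun x y => ∃ p, chainLeft st p = x ∧ chainRight st p = y) x y := by
  let S := Relation.EqvGen.setoid (fun x y => ∃ p, chainLeft st p = x ∧ chainRight st p = y)
  have edge : ∀ i z, S (chainLeft st (i, z)) (chainRight st (i, z)) := fun i z =>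
    .rel _ _ ⟨_, rfl, rfl⟩
  have edge' : ∀ i z {u v : {r // chainAlive st r = true}},
      chainRegion st i (leftTab (st i) z) = u.1 → chainRegion st i (rightTab (st i) z) = v.1 →
      S u v := by
    intro i z u v hu hv
    have h := edge i z
    rwa [show chainLeft st (i, z) = u from Subtype.ext hu,
      show chainRight st (i, z) = v from Subtype.ext hv] at h
  have h5 : ∀ i, S ⟨_, chainAlive_owner st i⟩ ⟨.inl true, rfl⟩ := fun i =>
    edge' i 3 (by rw [leftTab_three]; rfl) (by rw [rightTab_three]; rfl)
  have h6 : S ⟨.inl false, rfl⟩ ⟨.inl true, rfl⟩ :=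
    S.trans (edge' 0 9 (by rw [leftTab_nine]; rfl) (by rw [rightTab_nine]; rfl)) (h5 0)
  have key : ∀ u, S u ⟨.inl true, rfl⟩ := by
    rintro ⟨(_ | _) | ⟨i, l⟩, hr⟩
    · exact h6
    · exact S.refl _
    · obtain ⟨t1, t2, t3, t4⟩ := regions_connected_tab (st i)
      have h3 : ∀ hr, S ⟨.inr (i, 3), hr⟩ ⟨.inl true, rfl⟩ := fun hr => by
        obtain ⟨e1, e2⟩ := t3 (by simpa [chainAlive] using hr)
        exact edge' i 8 (by rw [e1]; rfl) (by rw [e2]; rfl)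
      fin_cases l
      · by_cases hi : cellTab (st i) 0 = true
        · have := h5 i
          simpa [owner, hi] using this
        · have h0 : i = 0 := by simpa [chainAlive, hi] using hr
          have := h5 i
          subst h0
          simpa [owner, hi] using this
      · obtain ⟨e1, e2⟩ := t1 (by simpa [chainAlive] using hr)
        exact edge' i 4 (by rw [e1]; rfl) (by rw [e2]; rfl)
      · have hs : cellTab (st i) 2 = true := by simpa [chainAlive] using hr
        rcases t2 hs with ⟨e1, e2⟩ | ⟨e1, e2⟩
        · have ha : chainAlive st (.inr (i, 3)) = true := by
            have : ∀ s, cellTab s 2 = true → cellTab s 3 = true := by decide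
            simp [chainAlive, this _ hs]
          exact S.trans (edge' i 5 (v := ⟨_, ha⟩) (by rw [e1]; rfl) (by rw [e2]; rfl)) (h3 ha)
        · exact edge' i 1 (by rw [e1]; rfl) (by rw [e2]; rfl)
      · exact h3 hr
      · obtain ⟨e1, e2⟩ := t4 (by simpa [chainAlive] using hr)
        exact S.trans (edge' i 6 (v := ⟨.inl false, rfl⟩) (by rw [e1]; rfl) (by rw [e2]; rfl)) h6
  exact S.trans (key x) (S.symm (key y))

theorem crossTab_crossTab : ∀ s x, crossTab s (crossTab s x) = x := by decide
theorem overTab_crossTab : ∀ s x, crossTab s x ≠ x →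
    overTab s (crossTab s x) = !(overTab s x) := by decide
theorem rtlTab_crossTab : ∀ s x, crossTab s x ≠ x →
    rtlTab s (crossTab s x) = !(rtlTab s x) := by decide
theorem tab_plain : ∀ s x, crossTab s x = x → overTab s x = false ∧ rtlTab s x = false := by decide

theorem chainCross_eq_iff {st : Fin (n + 1) → Fin 6} {i : Fin (n + 1)} {x : Fin 10} :
    chainCross st (i, x) = (i, x) ↔ crossTab (st i) x = x := by simp [chainCross]

/-- The chain of blocks in the given stages. -/
abbrev chain (st : Fin (n + 1) → Fin 6) (h : ValidChain st) : LinkDiagram where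
  P := ChainPoint n
  finP := inferInstance
  R := {r // chainAlive st r = true}
  finR := inferInstance
  next := chainNext n
  cross := chainCross st
  isOver := chainOver st
  rtl p := rtlTab (st p.1) p.2
  left := chainLeft st
  right := chainRight st
  cross_cross p := by simp [chainCross, crossTab_crossTab]
  isOver_cross p hp := overTab_crossTab _ _ fun h => hp (chainCross_eq_iff.2 h)
  rtl_cross p hp := rtlTab_crossTab _ _ fun h => hp (chainCross_eq_iff.2 h)
  isOver_plain p hp := (tab_plain _ _ (chainCross_eq_iff.1 hp)).1
  rtl_plain p hp := (tab_plain _ _ (chainCross_eq_iff.1 hp)).2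
  side_plain p hp := by
    obtain ⟨i, x⟩ := p
    obtain ⟨h1, h2⟩ := side_plain_tab _ _ (chainCross_eq_iff.1 hp)
    refine ⟨Subtype.ext ?_, Subtype.ext ?_⟩
    · rw [chainLeft_prev]
      rcases h1 with h1 | ⟨h1, h1', h3⟩
      · exact congrArg (chainRegion st i) h1
      · rw [h1', ← chainRegion_own_eq_prev h h3]
        exact congrArg (chainRegion st i) h1
    · rw [chainRight_prev]
      rcases h2 with h1 | ⟨h1, h1', h3⟩
      · exact congrArg (chainRegion st i) h1
      · rw [h1', ← chainRegion_own_eq_prev h h3]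
        exact congrArg (chainRegion st i) h1
  side_cross p hp := by
    obtain ⟨i, x⟩ := p
    obtain ⟨h1, h2, h3, h4⟩ := side_cross_tab (st i) x hp
    refine ⟨Subtype.ext ?_, Subtype.ext ?_, Subtype.ext ?_, Subtype.ext ?_⟩
    · exact congrArg (chainRegion st i) h1
    · rw [chainCross, chainRight_prev]
      exact congrArg (chainRegion st i) h2
    · rw [chainCross, chainRight_prev, chainLeft_prev]
      exact congrArg (chainRegion st i) h3
    · rw [chainCross, chainLeft_prev]
      exact congrArg (chainRegion st i) h4
  connected := chain_connected st
  euler := chain_euler h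

end Chain

/-! ### Reidemeister moves between chains -/

section ChainMoves

variable {n : ℕ}

theorem owner_zero (st : Fin (n + 1) → Fin 6) : owner st 0 = 0 := by simp [owner]

theorem owner_eq_or (st : Fin (n + 1) → Fin 6) (i : Fin (n + 1)) :
    owner st i = i ∨ owner st i = 0 := by
  by_cases h : cellTab (st i) 0 = true <;> simp [owner, h]

/-- The map of the regions that belongs to a change of the block `j`, where `ψ` renames
the regions of this block. -/
def collapse (st : Fin (n + 1) → Fin 6) (j : Fin (n + 1)) (ψ : Fin 8 → Fin 8) :
    ChainRegion n → ChainRegion n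
  | .inl b => .inl b
  | .inr (i, l) => if i = j then chainRegion st j (ψ (cellName l)) else .inr (i, l)

/-- The renaming `ψ` describes a removal of crossings in a block, from stage `s'` to
stage `s`, that does not change the names of the sides of the edges away from those in `X`. -/
structure Collapses (s s' : Fin 6) (ψ : Fin 8 → Fin 8) (X : Finset (Fin 10)) : Prop where
  fixed : ∀ y ∈ ({0, 5, 6, 7} : Finset (Fin 8)), ψ y = y
  alive : ∀ l : Fin 5, cellTab s' l = true → symAlive s (ψ (cellName l)) = true
  cell : cellTab s 0 = true → cellTab s' 0 = true
  sides : ∀ x, x ∉ X → ψ (leftTab s' x) = leftTab s x ∧ ψ (rightTab s' x) = rightTab s x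

variable {st st' : Fin (n + 1) → Fin 6} {j : Fin (n + 1)} {ψ : Fin 8 → Fin 8} {X : Finset (Fin 10)}

theorem collapse_alive (hst : ∀ i, i ≠ j → st' i = st i) (hc : Collapses (st j) (st' j) ψ X)
    (r : ChainRegion n) (hr : chainAlive st' r = true) :
    chainAlive st (collapse st j ψ r) = true := by
  obtain b | ⟨i, l⟩ := r
  · rfl
  · by_cases hi : i = j
    · subst hi
      simp only [collapse, if_true]
      refine chainAlive_chainRegion _ _ _ ?_
      simp only [chainAlive, Bool.or_eq_true, Bool.and_eq_true, decide_eq_true_eq] at hr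
      rcases hr with hr | ⟨rfl, -⟩
      · exact hc.alive l hr
      · have : ψ 0 = 0 := hc.fixed 0 (by decide)
        change symAlive _ (ψ 0) = true
        rw [this]
        rfl
    · simpa [collapse, hi, chainAlive, hst i hi] using hr

/-- If block `j` loses its crossings of $K_1$ and $K_2$, the region behind it is absorbed by the one
owned by block 0, the default value of `owner`. -/
theorem collapse_owner (hst : ∀ i, i ≠ j → st' i = st i) (hc : Collapses (st j) (st' j) ψ X)
    (i : Fin (n + 1)) : collapse st j ψ (.inr (owner st' i, 0)) = .inr (owner st i, 0) := by
  have h0 : ψ 0 = 0 := hc.fixed 0 (by decide)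
  have hj : collapse st j ψ (.inr (j, 0)) = .inr (owner st j, 0) := by
    simp only [collapse, if_true]
    change chainRegion st j (ψ 0) = _
    rw [h0]
    rfl
  by_cases hi : i = j
  · subst hi
    by_cases h : cellTab (st' i) 0 = true
    · rw [show owner st' i = i by simp [owner, h], hj]
    · have h1 : owner st' i = 0 := by simp [owner, h]
      have h2 : owner st i = 0 := by
        have : ¬ cellTab (st i) 0 = true := fun h' => h (hc.cell h')
        simp [owner, this]
      rw [h1, h2]
      by_cases hi0 : (0 : Fin (n + 1)) = i
      · rw [← hi0] at hj
        rw [← hi0, hj, owner_zero]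
      · simp [collapse, hi0]
  · have h1 : owner st' i = owner st i := by simp [owner, hst i hi]
    rw [h1]
    by_cases h2 : owner st i = j
    · have h3 : j = 0 := by
        rcases owner_eq_or st i with h | h
        · exact absurd (h.symm.trans h2) hi
        · exact h2.symm.trans h
      rw [h2, hj, h3, owner_zero]
    · simp [collapse, h2]

theorem collapse_chainRegion (hst : ∀ i, i ≠ j → st' i = st i)
    (hc : Collapses (st j) (st' j) ψ X) (i : Fin (n + 1)) (y : Fin 8) :
    collapse st j ψ (chainRegion st' i y) = chainRegion st i (if i = j then ψ y else y) := by
  have h0 : ψ 0 = 0 := hc.fixed 0 (by decide)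
  have h5 : ψ 5 = 5 := hc.fixed 5 (by decide)
  have h6 : ψ 6 = 6 := hc.fixed 6 (by decide)
  have h7 : ψ 7 = 7 := hc.fixed 7 (by decide)
  have hloc : ∀ l : Fin 5, collapse st j ψ (.inr (i, l)) =
      if i = j then chainRegion st i (ψ (cellName l)) else .inr (i, l) := by
    intro l
    by_cases hi : i = j
    · subst hi; rfl
    · simp [collapse, hi]
  have hsame : ∀ y, ψ y = y → (if i = j then ψ y else y) = y := by
    intro y hy
    rw [hy, ite_self]
  have hmid : ∀ l : Fin 5, l ≠ 0 → chainRegion st' i (cellName l) = .inr (i, l) ∧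
      chainRegion st i (cellName l) = .inr (i, l) := by
    intro l hl
    fin_cases l
    · exact absurd rfl hl
    all_goals exact ⟨rfl, rfl⟩
  have hmid' : ∀ l : Fin 5, l ≠ 0 →
      collapse st j ψ (chainRegion st' i (cellName l)) =
        chainRegion st i (if i = j then ψ (cellName l) else cellName l) := by
    intro l hl
    rw [(hmid l hl).1, hloc]
    by_cases hi : i = j
    · simp [hi]
    · simp [hi, (hmid l hl).2]
  fin_cases y
  · exact (collapse_owner hst hc i).trans (congrArg (chainRegion st i) (hsame _ h0).symm)
  · exact hmid' 1 (by decide)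
  · exact hmid' 2 (by decide)
  · exact hmid' 3 (by decide)
  · exact hmid' 4 (by decide)
  · exact congrArg (chainRegion st i) (hsame _ h5).symm
  · exact congrArg (chainRegion st i) (hsame _ h6).symm
  · exact (collapse_owner hst hc (i - 1)).trans (congrArg (chainRegion st i) (hsame _ h7).symm)

variable (h : ValidChain st) (h' : ValidChain st')

theorem chain_sidesAgreeOff (hst : ∀ i, i ≠ j → st' i = st i)
    (hc : Collapses (st j) (st' j) ψ X) {E : Set (ChainPoint n)} (hE : ∀ x ∈ X, (j, x) ∈ E) :
    SidesAgreeOff (chain st h) (chain st' h') (Equiv.refl (ChainPoint n))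
      (fun r => ⟨collapse st j ψ r.1, collapse_alive hst hc r.1 r.2⟩) E := by
  rintro ⟨i, x⟩ hp
  have key : ∀ y z, (i = j → ψ y = z) → (i ≠ j → y = z) →
      collapse st j ψ (chainRegion st' i y) = chainRegion st i z := by
    intro y z h1 h2
    rw [collapse_chainRegion hst hc]
    by_cases hi : i = j
    · rw [if_pos hi, h1 hi]
    · rw [if_neg hi, h2 hi]
  refine ⟨Subtype.ext (key _ _ ?_ ?_), Subtype.ext (key _ _ ?_ ?_)⟩
  · rintro rfl
    exact (hc.sides x fun hx => hp (hE x hx)).1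
  · intro hi
    simp [hst i hi]
  · rintro rfl
    exact (hc.sides x fun hx => hp (hE x hx)).2
  · intro hi
    simp [hst i hi]

theorem chain_agreeOff (hst : ∀ i, i ≠ j → st' i = st i) {S : Set (ChainPoint n)}
    (htab : ∀ x, x ∈ X ∨ crossTab (st' j) x = crossTab (st j) x ∧
      overTab (st' j) x = overTab (st j) x ∧ rtlTab (st' j) x = rtlTab (st j) x)
    (hS : ∀ x ∈ X, (j, x) ∈ S) :
    AgreeOff (chain st h) (chain st' h') (Equiv.refl (ChainPoint n)) S := by
  refine ⟨fun p => rfl, ?_⟩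
  rintro ⟨i, x⟩ hp
  by_cases hi : i = j
  · subst hi
    obtain ⟨h1, h2, h3⟩ := (htab x).resolve_left fun hx => hp (hS x hx)
    exact ⟨Prod.ext rfl h1, h2, h3⟩
  · refine ⟨Prod.ext rfl ?_, ?_, ?_⟩
    · exact congrArg (fun s => crossTab s x) (hst i hi)
    · exact congrArg (fun s => overTab s x) (hst i hi)
    · exact congrArg (fun s => rtlTab s x) (hst i hi)

/-- The names `1`, …, `4` are local to a block, so the border of such a region can be read off from
one row of the tables. -/
theorem chainRegion_eq_inr (st : Fin (n + 1) → Fin 6) (i j : Fin (n + 1)) (y : Fin 8) (l : Fin 5)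
    (hl : l ≠ 0) : chainRegion st i y = .inr (j, l) ↔ i = j ∧ y = cellName l := by
  fin_cases y <;> fin_cases l <;> simp [chainRegion, cellName, Fin.ext_iff] at hl ⊢

theorem chain_borders {l : Fin 5} (hl : l ≠ 0) (hal : chainAlive st (.inr (j, l)) = true)
    (htab : ∀ x, x ∈ X ↔ leftTab (st j) x = cellName l ∨
      rightTab (st j) x = cellName l)
    {E : Set (ChainPoint n)} (hE : ∀ p, p ∈ E ↔ p.1 = j ∧ p.2 ∈ X) :
    (chain st h).Borders ⟨.inr (j, l), hal⟩ E := by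
  rintro ⟨i, x⟩
  have h1 : (chain st h).left (i, x) = ⟨.inr (j, l), hal⟩ ↔
      i = j ∧ leftTab (st i) x = cellName l :=
    Subtype.ext_iff.trans (chainRegion_eq_inr st i j _ l hl)
  have h2 : (chain st h).right (i, x) = ⟨.inr (j, l), hal⟩ ↔
      i = j ∧ rightTab (st i) x = cellName l :=
    Subtype.ext_iff.trans (chainRegion_eq_inr st i j _ l hl)
  refine (hE _).trans (Iff.trans ?_ (or_congr h1 h2).symm)
  rw [← and_or_left]
  refine and_congr_right fun hi => ?_
  change i = j at hi
  subst hi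
  exact htab x

theorem chain_RI (hst : ∀ i, i ≠ j → st' i = st i) (hs : st j = 4) (hs' : st' j = 3) :
    RI (chain st h) (chain st' h') := by
  -- The monogon `4` is sent to `5`; this value is arbitrary, since its only edge is exempt.
  have hc : Collapses (st j) (st' j) ![0, 1, 2, 3, 5, 5, 6, 7] {6} := by
    rw [hs, hs']
    constructor <;> decide
  have hal : chainAlive st' (.inr (j, 4)) = true := by simp [chainAlive, hs', cellTab]
  refine ⟨Equiv.refl (ChainPoint n), _, ⟨.inr (j, 4), hal⟩, (j, 6), ?_, ?_, ?_, ?_, ?_, ?_,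
    chain_sidesAgreeOff h h' hst hc (E := {(j, 6)}) (by simp)⟩
  · exact fun he => absurd (congrArg Prod.snd he) (by decide : (7 : Fin 10) ≠ 6)
  · exact chain_agreeOff h h' (X := {6, 7}) hst (by rw [hs, hs']; decide)
      (by simp [chainNext, succTab])
  · exact Prod.ext rfl (by change crossTab (st j) 6 = 6; rw [hs]; rfl)
  · exact Prod.ext rfl (by change crossTab (st j) 7 = 7; rw [hs]; rfl)
  · exact Prod.ext rfl (by change crossTab (st' j) 6 = 7; rw [hs']; rfl)
  · exact chain_borders h' (X := {6}) (by decide) hal (by rw [hs']; decide)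
      (by simp [Prod.ext_iff])

/-- A second Reidemeister move between the strand of the over-passages `a`, `a + 1` and the strand
of the under-passages `b`, `b + 1`, described by the tables. -/
theorem chain_RII (hst : ∀ i, i ≠ j → st' i = st i) (a b a' b' : Fin 10) (l : Fin 5)
    (ha : ∀ i : Fin (n + 1), chainNext n (i, a) = (i, a'))
    (hb : ∀ i : Fin (n + 1), chainNext n (i, b) = (i, b'))
    (hnd : [a, a', b, b'].Nodup) (hl : l ≠ 0) (hal : cellTab (st' j) l = true)
    (hc : Collapses (st j) (st' j) ψ {a, b})
    (htab : ∀ x, x ∈ ({a, a', b, b'} : Finset (Fin 10)) ∨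
      crossTab (st' j) x = crossTab (st j) x ∧
      overTab (st' j) x = overTab (st j) x ∧ rtlTab (st' j) x = rtlTab (st j) x)
    (hp : crossTab (st j) a = a ∧ crossTab (st j) a' = a' ∧ crossTab (st j) b = b ∧
      crossTab (st j) b' = b')
    (hx : crossTab (st' j) a = b ∧ crossTab (st' j) a' = b')
    (ho : overTab (st' j) a = true ∧ overTab (st' j) a' = true)
    (hm : ∀ x, x ∈ ({a, b} : Finset (Fin 10)) ↔ leftTab (st' j) x = cellName l ∨
      rightTab (st' j) x = cellName l) :
    RII (chain st h) (chain st' h') := by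
  have hal' : chainAlive st' (.inr (j, l)) = true := by simp [chainAlive, hal]
  have ea : (chain st h).next (j, a) = (j, a') := ha j
  have eb : (chain st h).next (j, b) = (j, b') := hb j
  refine ⟨Equiv.refl (ChainPoint n), _, ⟨.inr (j, l), hal'⟩, (j, a), (j, b), ?_, ?_, ?_, ?_, ?_,
    ?_, Or.inl ⟨?_, ?_⟩, ?_, ?_, ?_,
    chain_sidesAgreeOff h h' hst hc (E := {(j, a), (j, b)}) (by simp)⟩
  · rw [ea, eb]
    exact hnd.map (f := Prod.mk j) fun x y hxy => congrArg Prod.snd hxy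
  · rw [ea, eb]
    refine chain_agreeOff h h' hst htab ?_
    intro x hx
    simp only [Finset.mem_insert, Finset.mem_singleton] at hx
    rcases hx with rfl | rfl | rfl | rfl <;> simp
  · exact Prod.ext rfl hp.1
  · rw [ea]
    exact Prod.ext rfl hp.2.1
  · exact Prod.ext rfl hp.2.2.1
  · rw [eb]
    exact Prod.ext rfl hp.2.2.2
  · exact Prod.ext rfl hx.1
  · rw [ea, eb]
    exact Prod.ext rfl hx.2
  · exact ho.1
  · rw [ea]
    exact ho.2
  · refine chain_borders h' hl hal' hm ?_
    rintro ⟨i, x⟩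
    simp [Prod.ext_iff, ← and_or_left]

theorem chain_RII_second (hst : ∀ i, i ≠ j → st' i = st i) (hs : st j = 2) (hs' : st' j = 1) :
    RII (chain st h) (chain st' h') := by
  -- $K_2$ passes over $K_1$ here. The regions `2` and `0` at the corners of the bigon `3` are
  -- joined; the image `5` of the bigon itself is immaterial.
  refine chain_RII h h' (ψ := ![0, 1, 0, 5, 4, 5, 6, 7]) hst 8 2 9 3 3 (fun _ => rfl)
    (fun _ => rfl) (by decide) (by decide) ?_ ?_ ?_ ?_ ?_ ?_ ?_ <;> simp only [hs, hs']
  · decide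
  · constructor <;> decide
  all_goals decide

theorem chain_RII_first (hst : ∀ i, i ≠ j → st' i = st i) (hs : st j = 3) (hs' : st' j = 2) :
    RII (chain st h) (chain st' h') := by
  -- The joined regions are those before and behind the block. This happens through `owner`, so `ψ`
  -- fixes both `0` and `7`.
  refine chain_RII h h' (ψ := ![0, 5, 2, 3, 4, 5, 6, 7]) hst 0 4 1 5 1 (fun _ => rfl)
    (fun _ => rfl) (by decide) (by decide) ?_ ?_ ?_ ?_ ?_ ?_ ?_ <;> simp only [hs, hs']
  · decide
  · constructor <;> decide
  all_goals decide

theorem chain_RII_link (hst : ∀ i, i ≠ j → st' i = st i) (hs : st j = 4) (hs' : st' j = 5) :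
    RII (chain st h) (chain st' h') := by
  refine chain_RII h h' (ψ := ![0, 5, 2, 3, 4, 5, 6, 7]) hst 0 4 1 5 1 (fun _ => rfl)
    (fun _ => rfl) (by decide) (by decide) ?_ ?_ ?_ ?_ ?_ ?_ ?_ <;> simp only [hs, hs']
  · decide
  · constructor <;> decide
  all_goals decide

/-- The exchange of the two points on each of the three strands at the triangle of a block. -/
def flipTab : Fin 10 → Fin 10 := ![0, 2, 1, 3, 4, 6, 5, 8, 7, 9]

def chainFlip (j : Fin (n + 1)) : Equiv.Perm (ChainPoint n) :=
  Function.Involutive.toPerm (fun p => (p.1, if p.1 = j then flipTab p.2 else p.2)) <| by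
    have hf : ∀ x, flipTab (flipTab x) = x := by decide
    rintro ⟨i, x⟩
    by_cases hi : i = j <;> simp [hi, hf]

theorem chainFlip_apply (i j : Fin (n + 1)) (x : Fin 10) :
    chainFlip j (i, x) = (i, if i = j then flipTab x else x) := rfl

theorem chainAlive_congr (hst : ∀ i, cellTab (st' i) = cellTab (st i)) (r : ChainRegion n) :
    chainAlive st' r = chainAlive st r := by
  obtain b | ⟨i, l⟩ := r
  · rfl
  · simp [chainAlive, hst]

theorem chainRegion_congr (hst : ∀ i, cellTab (st' i) = cellTab (st i)) (i : Fin (n + 1))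
    (y : Fin 8) : chainRegion st' i y = chainRegion st i y := by
  have : owner st' = owner st := funext fun i => by simp [owner, hst]
  simp [chainRegion, this]

/-- The upper strand `7`, `8` and the lower strand `5`, `6` are the two strands at the self-crossing
of $K_2$, and the middle strand `1`, `2` lies on $K_1$; they bound the triangle `2`. -/
theorem chain_RIIIAlpha (hst : ∀ i, i ≠ j → st' i = st i) (hs : st j = 0) (hs' : st' j = 1) :
    RIIIAlpha (chain st h) (chain st' h') := by
  have hcell : ∀ i, cellTab (st' i) = cellTab (st i) := by
    intro i
    by_cases hi : i = j
    · subst hi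
      rw [hs, hs']
      rfl
    · rw [hst i hi]
  have hal : chainAlive st (.inr (j, 2)) = true := by simp [chainAlive, hs, cellTab]
  have e7 : (chain st h).next (j, 7) = (j, 8) := rfl
  have e1 : (chain st h).next (j, 1) = (j, 2) := rfl
  have e5 : (chain st h).next (j, 5) = (j, 6) := rfl
  have hx : ∀ x, (chain st h).cross (j, x) = (j, crossTab 0 x) := fun x => by
    rw [← hs]; rfl
  have ho : ∀ x, (chain st h).isOver (j, x) = overTab 0 x := fun x => by
    rw [← hs]; rfl
  have hflip : ∀ x y : Fin 10, flipTab x = y → chainFlip j (j, x) = (j, y) := by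
    rintro x y rfl
    simp [chainFlip_apply]
  refine ⟨(j, 7), (j, 1), (j, 5), ⟨Equiv.refl (ChainPoint n),
    Equiv.subtypeEquivRight fun r => by rw [chainAlive_congr hcell],
    ⟨.inr (j, 2), hal⟩, chainFlip j, ?_, ?_, ?_, ?_, ?_, ?_, ?_, ?_, ?_, ?_, ?_, ?_, ?_, ?_, ?_,
    ?_, fun _ => rfl, ?_, ?_⟩, ?_, ?_⟩
  · rw [e7, e1, e5]
    exact (show [(7 : Fin 10), 8, 1, 2, 5, 6].Nodup by decide).map (f := Prod.mk j)
      fun x y hxy => congrArg Prod.snd hxy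
  · exact ⟨(j, 7), Or.inl rfl, by rw [hx]; exact Or.inl rfl⟩
  · exact ⟨(j, 2), Or.inr rfl, by rw [hx]; exact Or.inr rfl⟩
  · exact ⟨(j, 8), Or.inr rfl, by rw [hx]; exact Or.inl rfl⟩
  · rw [ho]; rfl
  · rw [e7, ho]; rfl
  · rw [ho]; rfl
  · rw [e5, ho]; rfl
  · refine chain_borders h (X := {7, 1, 5}) (by decide) hal (by rw [hs]; decide) ?_
    rintro ⟨i, x⟩
    simp [Prod.ext_iff, ← and_or_left]
  · exact hflip 7 8 rfl
  · exact hflip 8 7 rfl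
  · exact hflip 1 2 rfl
  · exact hflip 2 1 rfl
  · exact hflip 5 6 rfl
  · exact hflip 6 5 rfl
  · have ht : ∀ x, x ∉ ({7, 8, 1, 2, 5, 6} : Finset (Fin 10)) → flipTab x = x := by decide
    rintro ⟨i, x⟩ hp
    rw [e7, e1, e5] at hp
    by_cases hi : i = j
    · subst hi
      refine hflip x x (ht x fun hx => hp ?_)
      simp only [Finset.mem_insert, Finset.mem_singleton] at hx
      rcases hx with rfl | rfl | rfl | rfl | rfl | rfl <;> simp
    · simp [chainFlip_apply, hi]
  · have ht : ∀ x, crossTab 1 (flipTab x) = flipTab (crossTab 0 x) ∧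
        overTab 1 (flipTab x) = overTab 0 x ∧ rtlTab 1 (flipTab x) = rtlTab 0 x := by decide
    rintro ⟨i, x⟩
    by_cases hi : i = j
    · subst hi
      obtain ⟨t1, t2, t3⟩ := ht x
      rw [hflip x _ rfl]
      refine ⟨?_, ?_, ?_⟩
      · rw [hx, hflip _ _ rfl, ← t1, ← hs']
        rfl
      · rw [ho, ← t2, ← hs']
        rfl
      · change rtlTab (st' i) (flipTab x) = rtlTab (st i) x
        rw [hs, hs', t3]
    · have hf : ∀ x, chainFlip j (i, x) = (i, x) := fun x => by simp [chainFlip_apply, hi]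
      rw [hf]
      refine ⟨?_, ?_, ?_⟩
      · change (i, crossTab (st' i) x) = chainFlip j (i, crossTab (st i) x)
        rw [hf, hst i hi]
      · exact congrArg (fun s => overTab s x) (hst i hi)
      · exact congrArg (fun s => rtlTab s x) (hst i hi)
  · have ht : ∀ x, x ∉ ({7, 1, 5} : Finset (Fin 10)) → leftTab 1 x = leftTab 0 x ∧
        rightTab 1 x = rightTab 0 x := by decide
    rintro ⟨i, x⟩ hp
    have key : leftTab (st' i) x = leftTab (st i) x ∧ rightTab (st' i) x = rightTab (st i) x := by
      by_cases hi : i = j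
      · subst hi
        rw [hs, hs']
        refine ht x fun hx => hp ?_
        simp only [Finset.mem_insert, Finset.mem_singleton] at hx
        rcases hx with rfl | rfl | rfl <;> simp
      · rw [hst i hi]
        exact ⟨rfl, rfl⟩
    refine ⟨Subtype.ext ?_, Subtype.ext ?_⟩
    · exact (chainRegion_congr hcell i _).trans (congrArg (chainRegion st i) key.1)
    · exact (chainRegion_congr hcell i _).trans (congrArg (chainRegion st i) key.2)
  · exact fun hsc => absurd ((sameCycle_chainNext_iff _ _).1 hsc) (by decide : ¬ (false = true))
  · exact fun hsc => absurd ((sameCycle_chainNext_iff _ _).1 hsc) (by decide : ¬ (true = false))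

/-- The stages of the blocks after the blocks `1`, …, `k - 1` are made trivial, when the block `k` is
in stage `s`. -/
def stages (n k : ℕ) (s : Fin 6) (i : Fin (n + 1)) : Fin 6 :=
  if i = 0 then 5 else if i.val < k then 4 else if i.val = k then s else 0

/-- Blocks are cleared in order, so those without crossings of $K_1$ and $K_2$ form an interval
directly behind block 0, along which one region continues. -/
theorem validChain_stages (n k : ℕ) (s : Fin 6) : ValidChain (stages n k s) := by
  refine ⟨fun i hi => ?_, Or.inl (by simp [stages, cellTab])⟩
  have h0 : i ≠ 0 := by
    rintro rfl
    simp [stages, cellTab] at hi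
  have hk : i.val ≤ k := by
    by_contra hk
    have : stages n k s i = 0 := by
      simp [stages, h0, show ¬ i.val < k by omega, show ¬ i.val = k by omega]
    rw [this] at hi
    exact absurd hi (by decide)
  by_cases h1 : i - 1 = 0
  · rw [h1, owner_zero]
  · have h2 : (i - 1).val = i.val - 1 := Fin.val_sub_one_of_ne_zero h0
    have h3 : i.val ≠ 0 := fun h => h0 (Fin.ext h)
    have : stages n k s (i - 1) = 4 := by
      simp only [stages, h1, if_false]
      rw [if_pos (by omega)]
    simp [owner, this, cellTab]

theorem validChain_trivial (n : ℕ) : ValidChain (fun _ : Fin (n + 1) => 4) :=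
  ⟨fun i _ => by simp [owner, cellTab], Or.inr fun _ => rfl⟩

/-- The diagram with `n` blocks in stage `0`. -/
abbrev linkedChain (n : ℕ) : LinkDiagram := chain _ (validChain_stages n 1 0)

theorem stages_four (n k : ℕ) : stages n k 4 = stages n (k + 1) 0 := by
  funext i
  by_cases h0 : i = 0
  · simp [stages, h0]
  · simp only [stages, h0, if_false]
    split_ifs <;> first | rfl | omega

theorem chain_congr {st st' : Fin (n + 1) → Fin 6} (h : ValidChain st) (e : st = st')
    (h' : ValidChain st') : chain st h = chain st' h' := by
  subst e
  rfl

/-- Clearing a block costs exactly one RIII$\alpha$ move. The first and second moves are formulated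
as creating crossings and are used backwards. -/
theorem transforms_stages (n k : ℕ) (hk : k ≤ n) :
    Transforms (linkedChain n) (chain _ (validChain_stages n (k + 1) 0)) k := by
  induction k with
  | zero => exact .refl
  | succ k ih =>
    let j : Fin (n + 1) := ⟨k + 1, by omega⟩
    have hj0 : j ≠ 0 := fun h => by simpa [j] using congrArg Fin.val h
    have hoff : ∀ s s' i, i ≠ j → stages n (k + 1) s i = stages n (k + 1) s' i := by
      intro s s' i hi
      have : i.val ≠ k + 1 := fun h => hi (Fin.ext h)
      simp [stages, this]
    have hon : ∀ s, stages n (k + 1) s j = s := by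
      intro s
      simp only [stages, hj0, if_false]
      simp [j]
    have v := validChain_stages n (k + 1)
    have t1 := (ih (by omega)).alpha (F := chain _ (v 1))
      (Or.inl (chain_RIIIAlpha (v 0) (v 1) (hoff 1 0) (hon 0) (hon 1)))
    have t2 := t1.other (F := chain _ (v 2)) (Or.inr (Or.inr (Or.inr (Or.inr (Or.inl
      (chain_RII_second (v 2) (v 1) (hoff 1 2) (hon 2) (hon 1)))))))
    have t3 := t2.other (F := chain _ (v 3)) (Or.inr (Or.inr (Or.inr (Or.inr (Or.inl
      (chain_RII_first (v 3) (v 2) (hoff 2 3) (hon 3) (hon 2)))))))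
    have t4 := t3.other (F := chain _ (v 4)) (Or.inr (Or.inr (Or.inr (Or.inl
      (chain_RI (v 4) (v 3) (hoff 3 4) (hon 4) (hon 3))))))
    rwa [chain_congr (v 4) (stages_four n (k + 1)) (validChain_stages n (k + 2) 0)] at t4

theorem transforms_trivial (n : ℕ) :
    Transforms (linkedChain n) (chain _ (validChain_trivial n)) n := by
  -- Only the two crossings of block 0 are left. Their removal separates the curves, and the strip
  -- between them becomes an annulus.
  refine (transforms_stages n n le_rfl).other (Or.inr (Or.inr (Or.inr (Or.inr (Or.inl
    (chain_RII_link (j := 0) _ _ ?_ rfl ?_))))))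
  · intro i hi
    have := i.isLt
    simp [stages, hi, this]
  · simp [stages]

theorem linkedChain_isDiagramOfTrivialLink (n : ℕ) : (linkedChain n).IsDiagramOfTrivialLink 2 := by
  refine ⟨_, n, ?_, ?_, transforms_trivial n⟩
  · rintro ⟨i, x⟩
    exact Prod.ext rfl (crossTab_four x)
  · exact card_quotient_eq_two _ sameCycle_chainNext_iff

end ChainMoves

/-! ### The OU sequences of the chain -/

section ChainWords

variable {n : ℕ}

def letterTab (s : Fin 6) (x : Fin 10) : Option Bool :=
  if decide (x < 4) = decide (crossTab s x < 4) then none else some (overTab s x)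

theorem chain_letter {st : Fin (n + 1) → Fin 6} (h : ValidChain st) (p : ChainPoint n) :
    (chain st h).letter p = letterTab (st p.1) p.2 := by
  have key : (chain st h).SameComponent p ((chain st h).cross p) ↔
      decide (p.2 < 4) = decide (crossTab (st p.1) p.2 < 4) := sameCycle_chainNext_iff p _
  by_cases hp : decide (p.2 < 4) = decide (crossTab (st p.1) p.2 < 4)
  · rw [letter_eq_none (key.2 hp), letterTab, if_pos hp]
  · rw [letter_eq_some fun h => hp (key.1 h), letterTab, if_neg hp]
    rfl

/-- A curve spends `d` steps in each of the `n + 1` blocks. By `hz` a return to `z` takes a multiple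
of `d` steps, and `hit` then requires a multiple of `n + 1` blocks. -/
theorem chain_minimalPeriod {d : ℕ} {z : Fin 10} (hd : 0 < d)
    (hit : ∀ k, (chainNext n)^[d * k] (0, z) = (Fin.ofNat (n + 1) k, z))
    (hz : ∀ r < d, r ≠ 0 → ∀ i : Fin (n + 1), ((chainNext n)^[r] (i, z)).2 ≠ z) :
    Function.minimalPeriod (chainNext n) (0, z) = d * (n + 1) := by
  have hp : Function.IsPeriodicPt (chainNext n) (d * (n + 1)) (0, z) := by
    rw [Function.IsPeriodicPt, Function.IsFixedPt, hit]
    simp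
  refine le_antisymm (hp.minimalPeriod_le (by positivity)) ?_
  have hpos := minimalPeriod_perm_pos (chainNext n) (0, z)
  have hmin := Function.isPeriodicPt_minimalPeriod (chainNext n) (0, z)
  generalize Function.minimalPeriod (chainNext n) (0, z) = M at hpos hmin
  rw [Function.IsPeriodicPt, Function.IsFixedPt, ← Nat.mod_add_div M d,
    Function.iterate_add_apply, hit] at hmin
  have hr : M % d = 0 := by
    by_contra hr
    exact hz _ (Nat.mod_lt _ hd) hr _ (congrArg Prod.snd hmin)
  rw [hr] at hmin
  have hq : (M / d) % (n + 1) = 0 := by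
    have := congrArg (fun p : ChainPoint n => p.1.val) hmin
    simpa using this
  have hM : M = d * (M / d) := (Nat.mul_div_cancel' (Nat.dvd_of_mod_eq_zero hr)).symm
  have hq' : n + 1 ≤ M / d := by
    refine Nat.le_of_dvd (Nat.pos_of_ne_zero fun h => ?_) (Nat.dvd_of_mod_eq_zero hq)
    rw [h] at hM
    omega
  calc d * (n + 1) ≤ d * (M / d) := Nat.mul_le_mul_left d hq'
    _ = M := hM.symm

/-- The word of a component is composed of the words of the blocks. -/
theorem chain_word {d : ℕ} {z : Fin 10} (hd : 0 < d)
    (hit : ∀ k, (chainNext n)^[d * k] (0, z) = (Fin.ofNat (n + 1) k, z))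
    (hz : ∀ r < d, r ≠ 0 → ∀ i : Fin (n + 1), ((chainNext n)^[r] (i, z)).2 ≠ z)
    (g : ChainPoint n → Option Bool) (u v : List Bool) (hu : Even u.length) (hv : Even v.length)
    (h0 : ((List.range d).map fun r => (chainNext n)^[r] (0, z)).filterMap g = u)
    (h1 : ∀ i, i ≠ 0 → ((List.range d).map fun r => (chainNext n)^[r] (i, z)).filterMap g = v) :
    Even (word (chainNext n) g (0, z)).length ∧
      altSum (word (chainNext n) g (0, z)) = altSum u + n * altSum v := by
  -- Even length is carried along so that every block starts with the same sign and the alternating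
  -- sums add.
  have key : ∀ k ≤ n, ∃ w : List Bool,
      ((List.range (d * (k + 1))).map fun r => (chainNext n)^[r] (0, z)).filterMap g = w ∧
      Even w.length ∧ altSum w = altSum u + k * altSum v := by
    intro k hk
    induction k with
    | zero => exact ⟨u, by simpa using h0, hu, by simp⟩
    | succ k ih =>
      obtain ⟨w, hw, he, ha⟩ := ih (by omega)
      refine ⟨w ++ v, ?_, ?_, ?_⟩
      · rw [Nat.mul_succ d (k + 1), List.range_add, List.map_append, List.filterMap_append, hw]
        congr 1
        rw [List.map_map]
        refine Eq.trans ?_ (h1 (Fin.ofNat (n + 1) (k + 1)) ?_)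
        · congr 1
          refine List.map_congr_left fun r _ => ?_
          rw [Function.comp_apply, add_comm, Function.iterate_add_apply, hit]
        · intro h
          have := congrArg Fin.val h
          simp only [Fin.val_ofNat, Fin.val_zero] at this
          rw [Nat.mod_eq_of_lt (by omega)] at this
          omega
      · rw [List.length_append]
        exact he.add hv
      · rw [altSum_append, he.neg_one_pow, ha]
        push_cast
        ring
  obtain ⟨w, hw, he, ha⟩ := key n le_rfl
  rw [word, orbitList, chain_minimalPeriod hd hit hz, hw]
  exact ⟨he, ha⟩

theorem stages_ne_zero {i : Fin (n + 1)} (hi : i ≠ 0) : stages n 1 0 i = 0 := by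
  have : i.val ≠ 0 := fun h => hi (Fin.ext h)
  simp [stages, hi, show ¬ i.val < 1 by omega]

/-- Block 0 reads $OO$ with sum 0, and each of the other $n$ blocks reads $OUOU$ with sum $-4$. -/
theorem linkedChain_word_first (n : ℕ) :
    Even ((linkedChain n).ouSequence (0, 0)).length ∧
      (linkedChain n).ouNumber (0, 0) = 2 * (n : ℚ) := by
  have h := chain_word (n := n) (z := 0) (by decide : 0 < 4) chainNext_iterate_four ?_
    (linkedChain n).letter [true, true] [true, false, true, false] (by decide) (by decide) ?_ ?_
  · rw [ouNumber_eq, ouSequence_eq_word]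
    refine ⟨h.1, ?_⟩
    change 1 / 2 * |altSum (word (chainNext n) (linkedChain n).letter (0, 0))| = _
    rw [h.2]
    have : altSum [true, true] + n * altSum [true, false, true, false] = -(4 * n) := by
      simp only [altSum]
      norm_num
      ring
    rw [this, abs_neg, abs_of_nonneg (by positivity)]
    ring
  · intro r hr hr0 i
    interval_cases r
    · exact absurd rfl hr0
    · exact (by decide : (1 : Fin 10) ≠ 0)
    · exact (by decide : (2 : Fin 10) ≠ 0)
    · exact (by decide : (3 : Fin 10) ≠ 0)
  · change ([(0, 0), (0, 1), (0, 2), (0, 3)] : List (ChainPoint n)).filterMap _ = _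
    have : stages n 1 0 0 = 5 := rfl
    simp only [List.filterMap_cons, linkedChain, chain_letter, this]
    rfl
  · intro i hi
    change ([(i, 0), (i, 1), (i, 2), (i, 3)] : List (ChainPoint n)).filterMap _ = _
    simp only [List.filterMap_cons, linkedChain, chain_letter, stages_ne_zero hi]
    rfl

/-- Once the self-crossings are dropped, the blocks read $UU$ and $UUOO$, both with sum 0. -/
theorem linkedChain_word_second (n : ℕ) : (linkedChain n).ouNumber (0, 4) = 0 := by
  have h := chain_word (n := n) (z := 4) (by decide : 0 < 6) chainNext_iterate_six ?_
    (linkedChain n).letter [false, false] [false, false, true, true] (by decide) (by decide) ?_ ?_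
  · rw [ouNumber_eq]
    change 1 / 2 * |altSum (word (chainNext n) (linkedChain n).letter (0, 4))| = _
    rw [h.2]
    simp [altSum]
  · intro r hr hr0 i
    interval_cases r
    · exact absurd rfl hr0
    · exact (by decide : (5 : Fin 10) ≠ 4)
    · exact (by decide : (6 : Fin 10) ≠ 4)
    · exact (by decide : (7 : Fin 10) ≠ 4)
    · exact (by decide : (8 : Fin 10) ≠ 4)
    · exact (by decide : (9 : Fin 10) ≠ 4)
  · change ([(0, 4), (0, 5), (0, 6), (0, 7), (0, 8), (0, 9)] : List (ChainPoint n)).filterMap _ = _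
    have : stages n 1 0 0 = 5 := rfl
    simp only [List.filterMap_cons, linkedChain, chain_letter, this]
    rfl
  · intro i hi
    change ([(i, 4), (i, 5), (i, 6), (i, 7), (i, 8), (i, 9)] : List (ChainPoint n)).filterMap _ = _
    simp only [List.filterMap_cons, linkedChain, chain_letter, stages_ne_zero hi]
    rfl

end ChainWords

end LinkDiagram

theorem theorem4 (n : ℕ) :
    ∃ D : LinkDiagram,
      D.IsDiagramOfTrivialLink 2 ∧
      (∃ p q : D.P, ¬ D.SameComponent p q ∧ D.ouNumber p = 2 * (n : ℚ) ∧ D.ouNumber q = 0) ∧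
      ∀ (T : LinkDiagram) (m : ℕ), T.IsTrivial → LinkDiagram.Transforms D T m → n ≤ m := by
  obtain ⟨he, hn⟩ := LinkDiagram.linkedChain_word_first n
  refine ⟨LinkDiagram.linkedChain n, LinkDiagram.linkedChain_isDiagramOfTrivialLink n,
    ⟨(0, 0), (0, 4), ?_, hn, LinkDiagram.linkedChain_word_second n⟩, ?_⟩
  · exact fun h => absurd ((LinkDiagram.sameCycle_chainNext_iff _ _).1 h)
      (by decide : ¬ (true = false))
  · intro T m hT h
    have := LinkDiagram.ouNumber_le_of_transforms h hT _ he
    rw [hn] at this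
    exact_mod_cast (by linarith : (n : ℚ) ≤ m)
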